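/- Let $\Bbbk$ be an algebraically closed field of characteristic zero. Let $G$ be a finite abelian group, $\theta\ge 0$, $g_1,\dots,g_\theta\in G$, and let $\chi_1,\dots,\chi_\theta\colon G\to\Bbbk^\times$ be characters with $\chi_i(g_j)=\chi_j(g_i)^{-1}$ for $i\ne j$ and $m_i:=\operatorname{ord}(\chi_i(g_i))\ge 2$. The bosonization $B=B(G,\underline g,\underline\chi)$ of rank $\theta$ is the Hopf algebra over $\Bbbk$ generated by $G$ and $x_1,\dots,x_\theta$ subject to the relations of $G$ and $$x_i^{m_i}=0,\qquad x_ix_j=\chi_j(g_i)\,x_jx_i\ (i\neq j),\qquad hx_i=\chi_i(h)\,x_ih\ (h\in G),$$ where the elements of $G$ are grouplike and $\Delta(x_i)=g_i\otimes x_i+x_i\otimes 1$. Let $t\ge 1$, let $\mathbf p=(p_{ij})\in M_t(\Bbbk^\times)$ be multiplicatively antisymmetric ($p_{ii}=1$, $p_{ij}=p_{ji}^{-1}$), and let $\gamma=(\gamma_1,\dots,\gamma_t)\in(\Bbbk^\times)^t$. The multiparameter quantized Weyl algebra $A=A_t^{\mathbf p,\gamma}(\Bbbk)$ is the $\Bbbk$-algebra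 generated by $u_1,v_1,\dots,u_t,v_t$ subject to $$v_iv_j=p_{ij}v_jv_i\ (\text{all } i,j),\qquad u_iv_j=p_{ji}v_ju_i\ (i<j),\qquad u_iu_j=\gamma_ip_{ij}u_ju_i\ (i<j),$$ $$u_iv_j=\gamma_jp_{ji}v_ju_i\ (i>j),\qquad u_jv_j=1+\gamma_jv_ju_j+\sum_{\ell<j}(\gamma_\ell-1)v_\ell u_\ell\ (\text{all } j).$$ Set $\deg u_i=\deg v_i=i$ and let $\mathcal F=\{F_n\}_{n\ge 0}$ be the filtration of $A$ in which $F_n$ is the span of all products of generators of total degree at most $n$. The associated graded algebra $\operatorname{gr}_{\mathcal F}A$ is a quantum affine space on the $2t$ generators $u_1,v_1,\dots,u_t,v_t$; its parameters are the scalars $q_{ab}$ ($a\neq b$ generators) with $ab=q_{ab}\,ba$ in $\operatorname{gr}_{\mathcal F}A$, that is, up to inversion, $\gamma_i$ for all $i$, and $p_{ij}$ and $\gamma_ip_{ij}$ for $i<j$. Suppose that $A$ is a left $B$-module algebra, that the action is inner faithful (no nonzero Hopf ideal of $B$ annihilates $A$), and that it respects $\mathcal F$, i.e. $h\cdot F_n\subseteq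 F_n$ for all $h\in B$ and all $n$. Assume that all $\chi_i(g_i)$ ($1\le i\le\theta$) and all parameters $q_{ab}$ ($a\ne b$) of $\operatorname{gr}_{\mathcal F}A$ are roots of unity of order at least $3$. Then $$\operatorname{rank}B=\theta\le 2(2t-1).$$ -/

import Mathlib

open scoped TensorProduct

noncomputable section

/-! ### Gaussian binomial coefficients and nilpotency of `x + y` for `q`-commuting `x`, `y` -/

/-- The Gaussian binomial coefficient `n` choose `l` evaluated at `q`. -/
def gaussBinom {k : Type*} [Field k] (q : k) : ℕ → ℕ → k
  | _, 0 => 1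
  | 0, _ + 1 => 0
  | n + 1, l + 1 => gaussBinom q n l + q ^ (l + 1) * gaussBinom q n (l + 1)

theorem gaussBinom_zero_right {k : Type*} [Field k] (q : k) (n : ℕ) : gaussBinom q n 0 = 1 := by
  cases n <;> rfl

theorem gaussBinom_eq_zero_of_lt {k : Type*} [Field k] (q : k) (n l : ℕ) (h : n < l) :
    gaussBinom q n l = 0 := by
  induction n generalizing l with
  | zero => cases l with
    | zero => omega
    | succ l => rfl
  | succ n ih => cases l with
    | zero => omega
    | succ l => simp [gaussBinom, ih l (by omega), ih (l + 1) (by omega)]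

theorem gaussBinom_step {k : Type*} [Field k] (q : k) (n l : ℕ) :
    (q ^ (l + 1) - 1) * gaussBinom q n (l + 1) * q ^ l = (q ^ n - q ^ l) * gaussBinom q n l := by
  induction n generalizing l with
  | zero => cases l with
    | zero => simp [gaussBinom]
    | succ l => simp [gaussBinom]
  | succ n ih => cases l with
    | zero =>
      have h := ih 0
      simp only [gaussBinom, gaussBinom_zero_right] at h ⊢
      linear_combination q * h
    | succ l =>
      have h1 := ih l
      have h2 := ih (l + 1)
      rw [gaussBinom]
      conv_rhs => rw [gaussBinom]
      linear_combination q ^ (l + 2) * h2 + q * h1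

theorem gaussBinom_eq_zero {k : Type*} [Field k] (q : k) (hq : q ≠ 0) (l : ℕ)
    (hl : 0 < l) (hlm : l < orderOf q) : gaussBinom q (orderOf q) l = 0 := by
  induction l with
  | zero => omega
  | succ l ih =>
    have h := gaussBinom_step q (orderOf q) l
    have hz : (q ^ orderOf q - q ^ l) * gaussBinom q (orderOf q) l = 0 := by
      rcases Nat.eq_zero_or_pos l with rfl | h0
      · simp [pow_orderOf_eq_one]
      · rw [ih h0 (by omega), mul_zero]
    rw [hz] at h
    have h1 : q ^ (l + 1) - 1 ≠ 0 :=
      sub_ne_zero.2 (pow_ne_one_of_lt_orderOf (by omega) hlm)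
    simpa [h1, hq] using h

theorem qcomm_pow {k R : Type*} [Field k] [Ring R] [Algebra k R] (q : k) (x y : R)
    (h : y * x = q • (x * y)) (n : ℕ) : y * x ^ n = q ^ n • (x ^ n * y) := by
  induction n with
  | zero => simp
  | succ n ih =>
    rw [pow_succ, ← mul_assoc, ih, smul_mul_assoc, mul_assoc, h, mul_smul_comm, smul_smul,
      ← mul_assoc, pow_succ]

theorem qbinomial {k R : Type*} [Field k] [Ring R] [Algebra k R] (q : k) (x y : R)
    (h : y * x = q • (x * y)) (n : ℕ) :
    (x + y) ^ n = ∑ l ∈ Finset.range (n + 1), gaussBinom q n l • (x ^ l * y ^ (n - l)) := by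
  induction n with
  | zero => simp [gaussBinom]
  | succ n ih =>
    rw [pow_succ', ih, add_mul, Finset.mul_sum, Finset.mul_sum]
    conv_rhs => rw [Finset.sum_range_succ' _ (n + 1)]
    have e1 : ∀ l ∈ Finset.range (n + 1), x * (gaussBinom q n l • (x ^ l * y ^ (n - l))) =
        gaussBinom q n l • (x ^ (l + 1) * y ^ (n - l)) := by
      intro l _
      rw [mul_smul_comm, ← mul_assoc, pow_succ']
    have e2 : ∀ l ∈ Finset.range (n + 1), y * (gaussBinom q n l • (x ^ l * y ^ (n - l))) =
        (q ^ l * gaussBinom q n l) • (x ^ l * y ^ (n + 1 - l)) := by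
      intro l hl
      have hl' : n + 1 - l = (n - l) + 1 := by
        have := Finset.mem_range.1 hl
        omega
      rw [mul_smul_comm, ← mul_assoc, qcomm_pow q x y h, smul_mul_assoc, smul_smul, mul_assoc,
        hl', pow_succ' y, mul_comm]
    rw [Finset.sum_congr rfl e1, Finset.sum_congr rfl e2]
    conv_lhs => rw [Finset.sum_range_succ' (fun l => (q ^ l * gaussBinom q n l) •
      (x ^ l * y ^ (n + 1 - l))) n]
    have e3 : ∑ l ∈ Finset.range (n + 1),
        gaussBinom q (n + 1) (l + 1) • (x ^ (l + 1) * y ^ (n + 1 - (l + 1))) =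
        ∑ l ∈ Finset.range (n + 1), gaussBinom q n l • (x ^ (l + 1) * y ^ (n - l)) +
        ∑ l ∈ Finset.range n,
          (q ^ (l + 1) * gaussBinom q n (l + 1)) • (x ^ (l + 1) * y ^ (n + 1 - (l + 1))) := by
      have e4 : ∑ l ∈ Finset.range n,
          (q ^ (l + 1) * gaussBinom q n (l + 1)) • (x ^ (l + 1) * y ^ (n + 1 - (l + 1))) =
          ∑ l ∈ Finset.range (n + 1),
          (q ^ (l + 1) * gaussBinom q n (l + 1)) • (x ^ (l + 1) * y ^ (n + 1 - (l + 1))) := by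
        rw [Finset.sum_range_succ, gaussBinom_eq_zero_of_lt q n (n + 1) (by omega)]
        simp
      rw [e4, ← Finset.sum_add_distrib]
      refine Finset.sum_congr rfl fun l _ => ?_
      rw [gaussBinom, add_smul, Nat.add_sub_add_right]
    rw [e3]
    simp [gaussBinom_zero_right, add_assoc]

theorem qcomm_add_pow_eq_zero {k R : Type*} [Field k] [Ring R] [Algebra k R] (q : k) (hq : q ≠ 0)
    (x y : R) (h : y * x = q • (x * y))
    (hx : x ^ orderOf q = 0) (hy : y ^ orderOf q = 0) : (x + y) ^ orderOf q = 0 := by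
  rw [qbinomial q x y h]
  refine Finset.sum_eq_zero fun l hl => ?_
  have hl' := Finset.mem_range.1 hl
  rcases Nat.eq_zero_or_pos l with rfl | hpos
  · simp [hy]
  · rcases Nat.lt_or_ge l (orderOf q) with h1 | h1
    · rw [gaussBinom_eq_zero q hq l hpos h1, zero_smul]
    · have : l = orderOf q := by omega
      subst this
      simp [hx]

/-- For `y * x = q • (x * y)` with `q ≠ 0`, nilpotency of one factor passes to the product. -/
theorem qcomm_mul_pow_eq_zero {k R : Type*} [Field k] [Ring R] [Algebra k R] (q : k)
    (x y : R) (h : y * x = q • (x * y)) (m : ℕ) (hx : x ^ m = 0) : (y * x) ^ m = 0 := by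
  have key : ∀ n : ℕ, ∃ c : k, (y * x) ^ n = c • (x ^ n * y ^ n) := by
    intro n
    induction n with
    | zero => exact ⟨1, by simp⟩
    | succ n ih =>
      obtain ⟨c, hc⟩ := ih
      refine ⟨q ^ (n + 1) * c, ?_⟩
      calc (y * x) ^ (n + 1) = y * x * (c • (x ^ n * y ^ n)) := by rw [pow_succ', hc]
        _ = c • (y * x ^ (n + 1) * y ^ n) := by
            rw [mul_smul_comm, pow_succ']
            simp only [mul_assoc]
        _ = (q ^ (n + 1) * c) • (x ^ (n + 1) * y ^ (n + 1)) := by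
            rw [qcomm_pow q x y h, smul_mul_assoc, smul_smul, mul_assoc, ← pow_succ', mul_comm c]
  obtain ⟨c, hc⟩ := key m
  rw [hc, hx, zero_mul, smul_zero]

/-! ### Bosonizations of quantum linear spaces -/

/-- The data `(G, g, χ)` of rank `θ` defining a quantum linear space over the abelian group `G`. -/
structure QLSDatum (k G : Type*) [Field k] [CommGroup G] (θ : ℕ) where
  /-- the group elements `g₁, …, g_θ` -/
  g : Fin θ → G
  /-- the characters `χ₁, …, χ_θ` -/
  χ : Fin θ → G →* kˣ
  compat : ∀ i j, i ≠ j → χ i (g j) = (χ j (g i))⁻¹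
  two_le_order : ∀ i, 2 ≤ orderOf (χ i (g i))

namespace QLSDatum

variable {k G : Type*} [Field k] [CommGroup G] {θ : ℕ}

/-- The order `mᵢ` of `χᵢ(gᵢ)`. -/
def m (D : QLSDatum k G θ) (i : Fin θ) : ℕ := orderOf (D.χ i (D.g i))

/-- The defining relations of `B(G, g, χ)` in the free algebra on `G` and `x₁, …, x_θ`. -/
inductive Rel (D : QLSDatum k G θ) :
    FreeAlgebra k (G ⊕ Fin θ) → FreeAlgebra k (G ⊕ Fin θ) → Prop
  | grp_one : Rel D (FreeAlgebra.ι k (.inl 1)) 1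
  | grp_mul (a b : G) : Rel D (FreeAlgebra.ι k (.inl (a * b)))
      (FreeAlgebra.ι k (.inl a) * FreeAlgebra.ι k (.inl b))
  | x_pow (i : Fin θ) : Rel D (FreeAlgebra.ι k (.inr i) ^ D.m i) 0
  | x_mul_x (i j : Fin θ) (h : i ≠ j) :
      Rel D (FreeAlgebra.ι k (.inr i) * FreeAlgebra.ι k (.inr j))
        ((D.χ j (D.g i) : k) • (FreeAlgebra.ι k (.inr j) * FreeAlgebra.ι k (.inr i)))
  | grp_mul_x (a : G) (i : Fin θ) :
      Rel D (FreeAlgebra.ι k (.inl a) * FreeAlgebra.ι k (.inr i))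
        ((D.χ i a : k) • (FreeAlgebra.ι k (.inr i) * FreeAlgebra.ι k (.inl a)))

end QLSDatum

/-- The bosonization `B(G, g, χ)`, as an algebra; its Hopf structure is given below. -/
def Bosonization {k G : Type*} [Field k] [CommGroup G] {θ : ℕ} (D : QLSDatum k G θ) : Type _ :=
  RingQuot D.Rel

namespace Bosonization

variable {k G : Type*} [Field k] [CommGroup G] {θ : ℕ} (D : QLSDatum k G θ)

instance : Ring (Bosonization D) := inferInstanceAs (Ring (RingQuot D.Rel))

instance : Algebra k (Bosonization D) := inferInstanceAs (Algebra k (RingQuot D.Rel))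

/-- The quotient map from the free algebra. -/
def mk : FreeAlgebra k (G ⊕ Fin θ) →ₐ[k] Bosonization D := RingQuot.mkAlgHom k D.Rel

/-- The image of `a ∈ G`. -/
def grp (a : G) : Bosonization D := mk D (FreeAlgebra.ι k (.inl a))

/-- The generator `xᵢ`. -/
def x (i : Fin θ) : Bosonization D := mk D (FreeAlgebra.ι k (.inr i))

theorem mk_rel {a b : FreeAlgebra k (G ⊕ Fin θ)} (h : D.Rel a b) : mk D a = mk D b :=
  RingQuot.mkAlgHom_rel k h

theorem mk_surjective : Function.Surjective (mk D) := RingQuot.mkAlgHom_surjective k D.Rel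

theorem grp_one : grp D 1 = 1 := by
  simpa [grp] using mk_rel D .grp_one

theorem grp_mul (a b : G) : grp D (a * b) = grp D a * grp D b := by
  simpa [grp] using mk_rel D (.grp_mul a b)

theorem x_pow (i : Fin θ) : x D i ^ D.m i = 0 := by
  simpa [x] using mk_rel D (.x_pow i)

theorem x_mul_x (i j : Fin θ) (h : i ≠ j) :
    x D i * x D j = (D.χ j (D.g i) : k) • (x D j * x D i) := by
  simpa [x] using mk_rel D (.x_mul_x i j h)

theorem grp_mul_x (a : G) (i : Fin θ) :
    grp D a * x D i = (D.χ i a : k) • (x D i * grp D a) := by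
  simpa [x, grp] using mk_rel D (.grp_mul_x a i)

theorem grp_inv_mul (a : G) : grp D a⁻¹ * grp D a = 1 := by
  rw [← grp_mul, inv_mul_cancel, grp_one]

theorem grp_mul_inv (a : G) : grp D a * grp D a⁻¹ = 1 := by
  rw [← grp_mul, mul_inv_cancel, grp_one]

theorem grp_comm (a b : G) : grp D a * grp D b = grp D b * grp D a := by
  rw [← grp_mul, ← grp_mul, mul_comm]

theorem lift_rel {R : Type*} [Ring R] [Algebra k R] (γ : G → R) (ξ : Fin θ → R)
    (h1 : γ 1 = 1) (h2 : ∀ a b, γ (a * b) = γ a * γ b) (h3 : ∀ i, ξ i ^ D.m i = 0)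
    (h4 : ∀ i j, i ≠ j → ξ i * ξ j = (D.χ j (D.g i) : k) • (ξ j * ξ i))
    (h5 : ∀ a i, γ a * ξ i = (D.χ i a : k) • (ξ i * γ a))
    ⦃a b : FreeAlgebra k (G ⊕ Fin θ)⦄ (h : D.Rel a b) :
    FreeAlgebra.lift k (Sum.elim γ ξ) a = FreeAlgebra.lift k (Sum.elim γ ξ) b := by
  cases h with
  | grp_one => simpa using h1
  | grp_mul a b => simpa using h2 a b
  | x_pow i => simpa using h3 i
  | x_mul_x i j h => simpa using h4 i j h
  | grp_mul_x a i => simpa using h5 a i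

/-- The universal property of the presentation. -/
def lift {R : Type*} [Ring R] [Algebra k R] (γ : G → R) (ξ : Fin θ → R)
    (h1 : γ 1 = 1) (h2 : ∀ a b, γ (a * b) = γ a * γ b) (h3 : ∀ i, ξ i ^ D.m i = 0)
    (h4 : ∀ i j, i ≠ j → ξ i * ξ j = (D.χ j (D.g i) : k) • (ξ j * ξ i))
    (h5 : ∀ a i, γ a * ξ i = (D.χ i a : k) • (ξ i * γ a)) :
    Bosonization D →ₐ[k] R :=
  RingQuot.liftAlgHom k ⟨FreeAlgebra.lift k (Sum.elim γ ξ), lift_rel D γ ξ h1 h2 h3 h4 h5⟩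

theorem lift_mk {R : Type*} [Ring R] [Algebra k R] (γ : G → R) (ξ : Fin θ → R)
    (h1 : γ 1 = 1) (h2 : ∀ a b, γ (a * b) = γ a * γ b) (h3 : ∀ i, ξ i ^ D.m i = 0)
    (h4 : ∀ i j, i ≠ j → ξ i * ξ j = (D.χ j (D.g i) : k) • (ξ j * ξ i))
    (h5 : ∀ a i, γ a * ξ i = (D.χ i a : k) • (ξ i * γ a))
    (a : FreeAlgebra k (G ⊕ Fin θ)) :
    lift D γ ξ h1 h2 h3 h4 h5 (mk D a) = FreeAlgebra.lift k (Sum.elim γ ξ) a :=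
  RingQuot.liftAlgHom_mkAlgHom_apply k (FreeAlgebra.lift k (Sum.elim γ ξ))
    (lift_rel D γ ξ h1 h2 h3 h4 h5) a

theorem lift_grp {R : Type*} [Ring R] [Algebra k R] (γ : G → R) (ξ : Fin θ → R)
    (h1 : γ 1 = 1) (h2 : ∀ a b, γ (a * b) = γ a * γ b) (h3 : ∀ i, ξ i ^ D.m i = 0)
    (h4 : ∀ i j, i ≠ j → ξ i * ξ j = (D.χ j (D.g i) : k) • (ξ j * ξ i))
    (h5 : ∀ a i, γ a * ξ i = (D.χ i a : k) • (ξ i * γ a))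
    (a : G) : lift D γ ξ h1 h2 h3 h4 h5 (grp D a) = γ a := by
  rw [grp, lift_mk]
  simp

theorem lift_x {R : Type*} [Ring R] [Algebra k R] (γ : G → R) (ξ : Fin θ → R)
    (h1 : γ 1 = 1) (h2 : ∀ a b, γ (a * b) = γ a * γ b) (h3 : ∀ i, ξ i ^ D.m i = 0)
    (h4 : ∀ i j, i ≠ j → ξ i * ξ j = (D.χ j (D.g i) : k) • (ξ j * ξ i))
    (h5 : ∀ a i, γ a * ξ i = (D.χ i a : k) • (ξ i * γ a))
    (i : Fin θ) : lift D γ ξ h1 h2 h3 h4 h5 (x D i) = ξ i := by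
  rw [x, lift_mk]
  simp

theorem induction {P : Bosonization D → Prop} (hs : ∀ c : k, P (algebraMap k _ c))
    (hg : ∀ a, P (grp D a)) (hx : ∀ i, P (x D i)) (hmul : ∀ a b, P a → P b → P (a * b))
    (hadd : ∀ a b, P a → P b → P (a + b)) (a : Bosonization D) : P a := by
  obtain ⟨a, rfl⟩ := mk_surjective D a
  induction a using FreeAlgebra.induction with
  | grade0 r => simpa using hs r
  | grade1 z => cases z with
    | inl a => exact hg a
    | inr i => exact hx i
  | mul a b ha hb => simpa using hmul _ _ ha hb
  | add a b ha hb => simpa using hadd _ _ ha hb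

theorem algHom_ext {R : Type*} [Ring R] [Algebra k R] {f f' : Bosonization D →ₐ[k] R}
    (hg : ∀ a, f (grp D a) = f' (grp D a)) (hx : ∀ i, f (x D i) = f' (x D i)) : f = f' := by
  ext a
  induction a using induction with
  | hs c => simp
  | hg a => exact hg a
  | hx i => exact hx i
  | hmul a b ha hb => simp [ha, hb]
  | hadd a b ha hb => simp [ha, hb]

theorem orderOf_val (i : Fin θ) : orderOf ((D.χ i (D.g i) : kˣ) : k) = D.m i := orderOf_units

theorem m_pos (i : Fin θ) : 0 < D.m i := by
  have := D.two_le_order i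
  unfold QLSDatum.m
  omega

theorem compat_mul (i j : Fin θ) (h : i ≠ j) :
    (D.χ j (D.g i) : k) * (D.χ i (D.g j) : k) = 1 := by
  rw [D.compat i j h]
  simp

/-- The value `a ⊗ a` of the comultiplication on `a ∈ G`. -/
def comulGrp (a : G) : Bosonization D ⊗[k] Bosonization D := grp D a ⊗ₜ grp D a

/-- The value `gᵢ ⊗ xᵢ + xᵢ ⊗ 1` of the comultiplication on `xᵢ`. -/
def comulX (i : Fin θ) : Bosonization D ⊗[k] Bosonization D :=
  grp D (D.g i) ⊗ₜ x D i + x D i ⊗ₜ 1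

theorem comulGrp_one : comulGrp D 1 = 1 := by
  rw [comulGrp, grp_one, Algebra.TensorProduct.one_def]

theorem comulGrp_mul (a b : G) : comulGrp D (a * b) = comulGrp D a * comulGrp D b := by
  rw [comulGrp, comulGrp, comulGrp, grp_mul, Algebra.TensorProduct.tmul_mul_tmul]

theorem comulX_pow (i : Fin θ) : comulX D i ^ D.m i = 0 := by
  have hq := qcomm_add_pow_eq_zero (R := Bosonization D ⊗[k] Bosonization D)
    ((D.χ i (D.g i) : kˣ) : k) (Units.ne_zero _)
    (x D i ⊗ₜ 1) (grp D (D.g i) ⊗ₜ x D i)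
    (by simp [grp_mul_x, TensorProduct.smul_tmul'])
  rw [orderOf_val] at hq
  rw [comulX, add_comm]
  have hm := (m_pos D i).ne'
  exact hq (by simp [Algebra.TensorProduct.tmul_pow, x_pow])
    (by simp [Algebra.TensorProduct.tmul_pow, x_pow])

theorem comulX_mul (i j : Fin θ) (hij : i ≠ j) :
    comulX D i * comulX D j = (D.χ j (D.g i) : k) • (comulX D j * comulX D i) := by
  have hc := compat_mul D i j hij
  have e := x_mul_x D i j hij
  simp only [comulX, mul_add, add_mul, Algebra.TensorProduct.tmul_mul_tmul, one_mul, mul_one,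
    smul_add]
  rw [e, grp_mul_x D (D.g i) j, grp_mul_x D (D.g j) i, grp_comm D (D.g i) (D.g j)]
  simp only [← TensorProduct.smul_tmul', TensorProduct.tmul_smul, smul_smul, hc, one_smul]
  abel

theorem comulGrp_mul_comulX (a : G) (i : Fin θ) :
    comulGrp D a * comulX D i = (D.χ i a : k) • (comulX D i * comulGrp D a) := by
  simp only [comulGrp, comulX, mul_add, add_mul, Algebra.TensorProduct.tmul_mul_tmul, one_mul,
    mul_one, smul_add]
  rw [grp_mul_x, grp_comm D a (D.g i)]
  simp only [← TensorProduct.smul_tmul', TensorProduct.tmul_smul]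

/-- The comultiplication: `Δ(a) = a ⊗ a` for `a ∈ G`, and `Δ(xᵢ) = gᵢ ⊗ xᵢ + xᵢ ⊗ 1`. -/
def comulHom : Bosonization D →ₐ[k] Bosonization D ⊗[k] Bosonization D :=
  lift D (comulGrp D) (comulX D) (comulGrp_one D) (comulGrp_mul D) (comulX_pow D) (comulX_mul D)
    (comulGrp_mul_comulX D)

/-- The counit: `ε(a) = 1` for `a ∈ G`, and `ε(xᵢ) = 0`. -/
def counitHom : Bosonization D →ₐ[k] k :=
  lift D (fun _ => 1) (fun _ => 0) rfl (by simp)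
    (fun i => zero_pow (m_pos D i).ne') (by simp) (by simp)

theorem comulHom_grp (a : G) : comulHom D (grp D a) = grp D a ⊗ₜ grp D a := by
  unfold comulHom
  rw [lift_grp, comulGrp]

theorem comulHom_x (i : Fin θ) :
    comulHom D (x D i) = grp D (D.g i) ⊗ₜ x D i + x D i ⊗ₜ 1 := by
  unfold comulHom
  rw [lift_x, comulX]

theorem counitHom_grp (a : G) : counitHom D (grp D a) = 1 := by
  unfold counitHom
  rw [lift_grp]

theorem counitHom_x (i : Fin θ) : counitHom D (x D i) = 0 := by
  unfold counitHom
  rw [lift_x]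

instance : Bialgebra k (Bosonization D) :=
  Bialgebra.ofAlgHom (comulHom D) (counitHom D)
    (by
      apply algHom_ext
      · intro a
        simp [comulHom_grp]
      · intro i
        simp [comulHom_x, comulHom_grp, TensorProduct.add_tmul, TensorProduct.tmul_add,
          Algebra.TensorProduct.one_def, add_assoc])
    (by
      apply algHom_ext
      · intro a
        simp [comulHom_grp, counitHom_grp]
      · intro i
        simp [comulHom_x, counitHom_grp, counitHom_x])
    (by
      apply algHom_ext
      · intro a
        simp [comulHom_grp, counitHom_grp]
      · intro i
        simp [comulHom_x, counitHom_x])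

theorem comul_eq (a : Bosonization D) : Coalgebra.comul (R := k) a = comulHom D a := rfl

theorem counit_eq (a : Bosonization D) : Coalgebra.counit (R := k) a = counitHom D a := rfl

/-- The antipode as a homomorphism to the opposite algebra: `S(a) = a⁻¹` for `a ∈ G`, and
`S(xᵢ) = -gᵢ⁻¹ xᵢ`. -/
def antipodeHom : Bosonization D →ₐ[k] (Bosonization D)ᵐᵒᵖ :=
  lift D (fun a => .op (grp D a⁻¹)) (fun i => .op (-(grp D (D.g i)⁻¹ * x D i)))
    (by simp [grp_one])
    (by
      intro a b
      rw [← MulOpposite.op_mul, ← grp_mul, mul_inv_rev])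
    (by
      intro i
      rw [← MulOpposite.op_pow, neg_pow, qcomm_mul_pow_eq_zero _ _ _ (grp_mul_x D _ i) _ (x_pow D i),
        mul_zero, MulOpposite.op_zero])
    (by
      intro i j hij
      have hc := compat_mul D i j hij
      have e : ∀ i j : Fin θ, (grp D (D.g i)⁻¹ * x D i) * (grp D (D.g j)⁻¹ * x D j) =
          ((D.χ i (D.g j) : k)) • (grp D (D.g i)⁻¹ * grp D (D.g j)⁻¹ * (x D i * x D j)) := by
        intro i j
        have e1 : x D i * grp D (D.g j)⁻¹ =
            (D.χ i (D.g j) : k) • (grp D (D.g j)⁻¹ * x D i) := by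
          rw [grp_mul_x, smul_smul]
          simp
        calc (grp D (D.g i)⁻¹ * x D i) * (grp D (D.g j)⁻¹ * x D j)
            = grp D (D.g i)⁻¹ * (x D i * grp D (D.g j)⁻¹) * x D j := by simp only [mul_assoc]
          _ = _ := by rw [e1]; simp only [mul_assoc, mul_smul_comm, smul_mul_assoc]
      rw [← MulOpposite.op_mul, ← MulOpposite.op_mul, ← MulOpposite.op_smul, neg_mul_neg,
        neg_mul_neg, e i j, e j i, x_mul_x D i j hij, grp_comm D (D.g j)⁻¹ (D.g i)⁻¹,
        mul_smul_comm, smul_smul (D.χ i (D.g j) : k), mul_comm (D.χ i (D.g j) : k), hc, one_smul])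
    (by
      intro a i
      rw [← MulOpposite.op_mul, ← MulOpposite.op_mul, ← MulOpposite.op_smul]
      congr 1
      have e1 : x D i * grp D a⁻¹ = (D.χ i a : k) • (grp D a⁻¹ * x D i) := by
        rw [grp_mul_x, smul_smul]
        simp
      rw [neg_mul, mul_assoc, e1, mul_neg, smul_neg, mul_smul_comm, ← mul_assoc, ← mul_assoc,
        grp_comm])

/-- The antipode. -/
def antipodeLin : Bosonization D →ₗ[k] Bosonization D :=
  (MulOpposite.opLinearEquiv k).symm.toLinearMap ∘ₗ (antipodeHom D).toLinearMap

theorem antipodeLin_mul (a b : Bosonization D) :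
    antipodeLin D (a * b) = antipodeLin D b * antipodeLin D a := by
  simp [antipodeLin]

theorem antipodeLin_algebraMap (c : k) :
    antipodeLin D (algebraMap k _ c) = algebraMap k _ c := by
  simp [antipodeLin]

theorem antipodeLin_one : antipodeLin D 1 = 1 := by
  simp [antipodeLin]

theorem antipodeLin_grp (a : G) : antipodeLin D (grp D a) = grp D a⁻¹ := by
  have : antipodeHom D (grp D a) = .op (grp D a⁻¹) := by
    unfold antipodeHom
    rw [lift_grp]
  simp [antipodeLin, this]

theorem antipodeLin_x (i : Fin θ) :
    antipodeLin D (x D i) = -(grp D (D.g i)⁻¹ * x D i) := by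
  have : antipodeHom D (x D i) = .op (-(grp D (D.g i)⁻¹ * x D i)) := by
    unfold antipodeHom
    rw [lift_x]
  simp [antipodeLin, this]

theorem antipode_left (a : Bosonization D) :
    LinearMap.mul' k _ ((antipodeLin D).rTensor _ (comulHom D a)) =
      algebraMap k _ (counitHom D a) := by
  induction a using induction with
  | hs c => simp [Algebra.TensorProduct.algebraMap_apply, antipodeLin_algebraMap]
  | hg a => simp [comulHom_grp, counitHom_grp, antipodeLin_grp, grp_inv_mul]
  | hx i => simp [comulHom_x, counitHom_x, antipodeLin_grp, antipodeLin_x]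
  | hadd a b ha hb => simp [ha, hb]
  | hmul a b ha hb =>
    have key : ∀ s t : Bosonization D ⊗[k] Bosonization D, ∀ c : k,
        LinearMap.mul' k _ ((antipodeLin D).rTensor _ s) = algebraMap k _ c →
        LinearMap.mul' k _ ((antipodeLin D).rTensor _ (s * t)) =
          algebraMap k _ c * LinearMap.mul' k _ ((antipodeLin D).rTensor _ t) := by
      intro s t c hs
      rw [← hs]
      induction t with
      | zero => simp
      | add t t' ht ht' => simp only [mul_add, map_add, ht, ht']
      | tmul b b' =>
        have h2 : ∀ s : Bosonization D ⊗[k] Bosonization D,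
            LinearMap.mul' k _ ((antipodeLin D).rTensor _ (s * (b ⊗ₜ b'))) =
            antipodeLin D b * LinearMap.mul' k _ ((antipodeLin D).rTensor _ s) * b' := by
          intro s
          induction s with
          | zero => simp
          | add s s' h h' => simp only [add_mul, mul_add, map_add, h, h']
          | tmul a a' => simp [antipodeLin_mul, mul_assoc]
        rw [h2, hs, LinearMap.rTensor_tmul, LinearMap.mul'_apply, ← Algebra.commutes, mul_assoc]
    rw [map_mul, key _ _ _ ha, hb, map_mul, map_mul]

theorem antipode_right (a : Bosonization D) :
    LinearMap.mul' k _ ((antipodeLin D).lTensor _ (comulHom D a)) =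
      algebraMap k _ (counitHom D a) := by
  induction a using induction with
  | hs c =>
    simp [Algebra.TensorProduct.algebraMap_apply, antipodeLin_one]
  | hg a => simp [comulHom_grp, counitHom_grp, antipodeLin_grp, grp_mul_inv]
  | hx i =>
    simp [comulHom_x, counitHom_x, antipodeLin_one, antipodeLin_x, ← mul_assoc, grp_mul_inv]
  | hadd a b ha hb => simp [ha, hb]
  | hmul a b ha hb =>
    have key : ∀ s t : Bosonization D ⊗[k] Bosonization D, ∀ c : k,
        LinearMap.mul' k _ ((antipodeLin D).lTensor _ t) = algebraMap k _ c →
        LinearMap.mul' k _ ((antipodeLin D).lTensor _ (s * t)) =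
          LinearMap.mul' k _ ((antipodeLin D).lTensor _ s) * algebraMap k _ c := by
      intro s t c ht
      rw [← ht]
      induction s with
      | zero => simp
      | add s s' hs hs' => simp only [add_mul, map_add, hs, hs']
      | tmul b b' =>
        have h2 : ∀ t : Bosonization D ⊗[k] Bosonization D,
            LinearMap.mul' k _ ((antipodeLin D).lTensor _ ((b ⊗ₜ b') * t)) =
            b * LinearMap.mul' k _ ((antipodeLin D).lTensor _ t) * antipodeLin D b' := by
          intro t
          induction t with
          | zero => simp
          | add s s' h h' => simp only [add_mul, mul_add, map_add, h, h']
          | tmul a a' => simp [antipodeLin_mul, mul_assoc]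
        rw [h2, ht, LinearMap.lTensor_tmul, LinearMap.mul'_apply, mul_assoc, Algebra.commutes,
          ← mul_assoc]
    rw [map_mul, key _ _ _ hb, ha, map_mul, map_mul]

instance : HopfAlgebra k (Bosonization D) where
  antipode := antipodeLin D
  mul_antipode_rTensor_comul := LinearMap.ext (antipode_left D)
  mul_antipode_lTensor_comul := LinearMap.ext (antipode_right D)

end Bosonization

/-! ### Hopf actions -/

/-- An action of the Hopf algebra `H` on the algebra `A`, i.e. an `H`-module algebra structure. -/
structure HopfAction (k H A : Type*) [Field k] [Ring H] [HopfAlgebra k H] [Ring A]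
    [Algebra k A] where
  /-- the action map `h ↦ (a ↦ h · a)` -/
  act : H →ₐ[k] Module.End k A
  /-- `h · 1 = ε(h) 1` -/
  act_one : ∀ h : H, act h 1 = algebraMap k A (Coalgebra.counit h)
  /-- `h · (a a') = ∑ (h₁ · a) (h₂ · a')` -/
  act_mul : ∀ (h : H) (a a' : A), act h (a * a') =
    LinearMap.mul' k A
      (TensorProduct.map (act.toLinearMap.flip a) (act.toLinearMap.flip a')
        (Coalgebra.comul (R := k) h))

namespace HopfAction

variable {k H A : Type*} [Field k] [Ring H] [HopfAlgebra k H] [Ring A] [Algebra k A]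

/-- No nonzero Hopf ideal annihilates `A`. -/
def InnerFaithful (ρ : HopfAction k H A) : Prop :=
  ∀ I : Ideal H, I.IsTwoSided → I.IsHopfIdeal k → (∀ h ∈ I, ∀ a : A, ρ.act h a = 0) → I = ⊥

/-- `h · F n ⊆ F n` for all `h` and `n`. -/
def Respects (ρ : HopfAction k H A) (F : ℕ → Submodule k A) : Prop :=
  ∀ (n : ℕ) (h : H), ∀ a ∈ F n, ρ.act h a ∈ F n

end HopfAction

/-! ### Multiparameter quantized Weyl algebras -/

/-- A multiplicatively antisymmetric matrix. -/
def IsMulAntisymm {k ι : Type*} [Field k] (p : Matrix ι ι kˣ) : Prop :=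
  (∀ i, p i i = 1) ∧ ∀ i j, p i j = (p j i)⁻¹

namespace QWeyl

variable {k : Type*} [Field k] {t : ℕ}

/-- The letters: `.inl i` stands for `uᵢ`, and `.inr i` for `vᵢ`. -/
abbrev Letter (t : ℕ) : Type := Fin t ⊕ Fin t

/-- `uᵢ` in the free algebra. -/
abbrev fu (k : Type*) [Field k] {t : ℕ} (i : Fin t) : FreeAlgebra k (Letter t) :=
  FreeAlgebra.ι k (.inl i)

/-- `vᵢ` in the free algebra. -/
abbrev fv (k : Type*) [Field k] {t : ℕ} (i : Fin t) : FreeAlgebra k (Letter t) :=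
  FreeAlgebra.ι k (.inr i)

/-- The defining relations of the quantized Weyl algebra. -/
inductive Rel (p : Matrix (Fin t) (Fin t) kˣ) (γ : Fin t → kˣ) :
    FreeAlgebra k (Letter t) → FreeAlgebra k (Letter t) → Prop
  | vv (i j : Fin t) : Rel p γ (fv k i * fv k j) ((p i j : k) • (fv k j * fv k i))
  | uv_lt (i j : Fin t) (h : i < j) :
      Rel p γ (fu k i * fv k j) ((p j i : k) • (fv k j * fu k i))
  | uu (i j : Fin t) (h : i < j) :
      Rel p γ (fu k i * fu k j) ((γ i * p i j : k) • (fu k j * fu k i))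
  | uv_gt (i j : Fin t) (h : j < i) :
      Rel p γ (fu k i * fv k j) ((γ j * p j i : k) • (fv k j * fu k i))
  | uv (j : Fin t) :
      Rel p γ (fu k j * fv k j)
        (1 + (γ j : k) • (fv k j * fu k j) +
          ∑ l ∈ Finset.univ.filter (· < j), ((γ l : k) - 1) • (fv k l * fu k l))

end QWeyl

/-- The multiparameter quantized Weyl algebra `A_t^{p,γ}(k)`. -/
def QWeyl {k : Type*} [Field k] {t : ℕ} (p : Matrix (Fin t) (Fin t) kˣ) (γ : Fin t → kˣ) : Type _ :=
  RingQuot (QWeyl.Rel p γ)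

namespace QWeyl

variable {k : Type*} [Field k] {t : ℕ} (p : Matrix (Fin t) (Fin t) kˣ) (γ : Fin t → kˣ)

instance : Ring (QWeyl p γ) := inferInstanceAs (Ring (RingQuot (QWeyl.Rel p γ)))

instance : Algebra k (QWeyl p γ) := inferInstanceAs (Algebra k (RingQuot (QWeyl.Rel p γ)))

/-- The generators of the quantized Weyl algebra. -/
def gen (a : Letter t) : QWeyl p γ := RingQuot.mkAlgHom k (QWeyl.Rel p γ) (FreeAlgebra.ι k a)

/-- `deg uᵢ = deg vᵢ = i` (the index set `Fin t` starts at `0`, hence the shift). -/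
def deg : Letter t → ℕ
  | .inl i => i + 1
  | .inr i => i + 1

/-- The filtration `F`: the part `F n` is spanned by the words of degree at most `n`. -/
def filtration (n : ℕ) : Submodule k (QWeyl p γ) :=
  Submodule.span k
    {a | ∃ w : List (Letter t), (w.map deg).sum ≤ n ∧ a = (w.map (gen p γ)).prod}

/-- The parameters of the quantum affine space `gr_F A`: the classes of the generators `a`, `b`
satisfy `a b = grParam p γ a b • b a` there. -/
def grParam : Letter t → Letter t → kˣ
  | .inl i, .inl j => if i < j then γ i * p i j else if j < i then (γ j * p j i)⁻¹ else 1
  | .inl i, .inr j => if i < j then p j i else γ j * p j i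
  | .inr i, .inl j => if j < i then (p i j)⁻¹ else (γ i * p i j)⁻¹
  | .inr i, .inr j => p i j

end QWeyl

end

/-! Put `z_n = 1 + ∑_{l<n} (γ_l - 1) v_l u_l`, with indices from `0`. As `(γ_i - 1) v_i u_i =
z_{i+1} - z_i`, the generator `u_i` can be expressed through `z_i`, `z_{i+1}` and `v_i⁻¹`, and `A`
embeds in the quantum torus on the `z_{i+1}` and `v_i` (`toTorus_injective`). Relations in `A`
thereby become identities for the alternating bimultiplicative pairing `comm` of exponents in
`ℤ^{2t}`. The generator `a` has leading exponent `ex a`.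

Group elements. Since `γ_i² ≠ 1`, an automorphism that respects the filtration, together with its
inverse, scales `u_i` and `v_i` by inverse scalars (`isDiagAt`). So `h ∈ G` acts on monomials by a
character `W_h` of exponents, trivial on the `z_n` (`exists_char`).

Skew primitives. By inner faithfulness `x_l` acts as a nonzero skew derivation `X`
(`act_x_ne_zero`). Let `a` be a generator of least index with `X a ≠ 0`, `m` a suitable exponent of
`X a`, and `d = m - ex a`. Applying `X` to the relations of `a` with the other generators shows that
`comm d` agrees with `W = W_{g_l}` on the exponents of lower index and on that of the partner of `a`
(`exists_agree`). With `comm d d = 1` this yields `comm d z_{idx a + 1} = W d = χ_l(g_l)`. If there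
were letters of the next index, the relations with them would make the same pairing equal to `1`,
against `χ_l(g_l) ≠ 1`. Hence `a` is one of the two generators of top degree (`exists_source`).

Counting. Weights give `χ_l(h) = W_h(d_l)` for all `h`. If `i ≠ j` have the same `a`, then `comm d_i
d_j * χ_i(g_i) = χ_j(g_i)` and symmetrically; multiplying, `χ_i(g_i) χ_j(g_j) = χ_j(g_i) χ_i(g_j) =
1`. Three such indices would give some `χ_j(g_j)² = 1`, so each of the two generators serves at most
two indices, and `θ ≤ 4 ≤ 2(2t - 1)` when `t ≥ 2`. For `t = 1` the relation between `u` and `v`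
forces `W_{g_l}(v) = γ⁻¹` for every `l`. The characters `W_{g_l}` then coincide, the products are
`1` whatever the `a`, and `θ ≤ 2`. -/

noncomputable section

/-! ### Quantum tori -/

namespace QTorus

variable {k ι : Type*} [Field k] [Fintype ι] (P : Matrix ι ι kˣ)

/-- The bimultiplicative cocycle on `ι → ℤ` with matrix `P`. -/
def cocycle (m n : ι → ℤ) : kˣ := ∏ i, ∏ j, P i j ^ (m i * n j)

theorem cocycle_add_left (m m' n : ι → ℤ) :
    cocycle P (m + m') n = cocycle P m n * cocycle P m' n := by
  simp [cocycle, add_mul, zpow_add, Finset.prod_mul_distrib]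

theorem cocycle_add_right (m n n' : ι → ℤ) :
    cocycle P m (n + n') = cocycle P m n * cocycle P m n' := by
  simp [cocycle, mul_add, zpow_add, Finset.prod_mul_distrib]

theorem cocycle_zero_left (n : ι → ℤ) : cocycle P 0 n = 1 := by simp [cocycle]

theorem cocycle_zero_right (m : ι → ℤ) : cocycle P m 0 = 1 := by simp [cocycle]

theorem cocycle_single_single [DecidableEq ι] (i j : ι) :
    cocycle P (Pi.single i 1) (Pi.single j 1) = P i j := by
  rw [cocycle, Finset.prod_eq_single i, Finset.prod_eq_single j]
  · simp
  · intro b _ hb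
    simp [hb]
  · simp
  · intro b _ hb
    simp [hb]
  · simp

/-- The scalar `comm m n` with `xᵐ xⁿ = comm m n • xⁿ xᵐ` in the quantum torus. -/
def comm (m n : ι → ℤ) : kˣ := cocycle P m n * (cocycle P n m)⁻¹

theorem comm_add_left (m m' n : ι → ℤ) :
    comm P (m + m') n = comm P m n * comm P m' n := by
  simp only [comm, cocycle_add_left, cocycle_add_right, mul_inv]
  exact mul_mul_mul_comm _ _ _ _

theorem comm_add_right (m n n' : ι → ℤ) :
    comm P m (n + n') = comm P m n * comm P m n' := by
  simp only [comm, cocycle_add_left, cocycle_add_right, mul_inv]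
  exact mul_mul_mul_comm _ _ _ _

theorem comm_zero_left (n : ι → ℤ) : comm P 0 n = 1 := by
  simp [comm, cocycle_zero_left, cocycle_zero_right]

theorem comm_zero_right (n : ι → ℤ) : comm P n 0 = 1 := by
  simp [comm, cocycle_zero_left, cocycle_zero_right]

theorem comm_self (n : ι → ℤ) : comm P n n = 1 := by simp [comm]

theorem comm_swap (m n : ι → ℤ) : comm P m n = (comm P n m)⁻¹ := by
  simp [comm, mul_comm]

/-- `comm m ·` as a character. -/
def commChar (m : ι → ℤ) : AddChar (ι → ℤ) kˣ where
  toFun := comm P m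
  map_zero_eq_one' := comm_zero_right P m
  map_add_eq_mul' := comm_add_right P m

theorem commChar_apply (m n : ι → ℤ) : commChar P m n = comm P m n := rfl

theorem comm_neg_right (m n : ι → ℤ) : comm P m (-n) = (comm P m n)⁻¹ :=
  AddChar.map_neg_eq_inv (commChar P m) n

theorem comm_neg_left (m n : ι → ℤ) : comm P (-m) n = (comm P m n)⁻¹ := by
  rw [comm_swap, comm_neg_right, comm_swap P n m, inv_inv]

theorem comm_sub_left (m m' n : ι → ℤ) : comm P (m - m') n = comm P m n * (comm P m' n)⁻¹ := by
  rw [sub_eq_add_neg, comm_add_left, comm_neg_left]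

theorem comm_sub_right (m n n' : ι → ℤ) : comm P m (n - n') = comm P m n * (comm P m n')⁻¹ := by
  rw [sub_eq_add_neg, comm_add_right, comm_neg_right]

theorem comm_single_single [DecidableEq ι] (i j : ι) :
    comm P (Pi.single i 1) (Pi.single j 1) = P i j * (P j i)⁻¹ := by
  rw [comm, cocycle_single_single, cocycle_single_single]

theorem cocycle_eq_comm_mul (m n : ι → ℤ) : cocycle P m n = comm P m n * cocycle P n m := by
  simp [comm]

/-- Characters of `ι → ℤ` agree at `n` if they agree on the basis vectors in the support of `n`. -/
theorem addChar_eq_of_single [DecidableEq ι] {M : Type*} [CommGroup M] (ψ ψ' : AddChar (ι → ℤ) M)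
    (n : ι → ℤ) (h : ∀ i, n i ≠ 0 → ψ (Pi.single i 1) = ψ' (Pi.single i 1)) : ψ n = ψ' n := by
  have key : ∀ φ : AddChar (ι → ℤ) M, φ n = ∏ i, φ (Pi.single i 1) ^ n i := by
    intro φ
    conv_lhs => rw [← Finset.univ_sum_single n]
    have hs : ∀ f : ι → ι → ℤ, φ (∑ i, f i) = ∏ i, φ (f i) := fun f =>
      map_prod φ.toMonoidHom (fun i => Multiplicative.ofAdd (f i)) Finset.univ
    rw [hs]
    refine Finset.prod_congr rfl fun i _ => ?_
    rw [← AddChar.map_zsmul_eq_zpow, ← Pi.single_smul]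
    simp
  rw [key, key]
  refine Finset.prod_congr rfl fun i _ => ?_
  by_cases hi : n i = 0
  · simp [hi]
  · rw [h i hi]

/-- Left multiplication by the monomial with exponent `m`. -/
def leftMul (m : ι → ℤ) : Module.End k ((ι → ℤ) →₀ k) :=
  Finsupp.lsum k fun n => (cocycle P m n : k) • Finsupp.lsingle (m + n)

/-- Right multiplication by the monomial with exponent `n`. -/
def rightMul (n : ι → ℤ) : Module.End k ((ι → ℤ) →₀ k) :=
  Finsupp.lsum k fun m => (cocycle P m n : k) • Finsupp.lsingle (m + n)

theorem leftMul_single (m n : ι → ℤ) (c : k) :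
    leftMul P m (Finsupp.single n c) = Finsupp.single (m + n) (cocycle P m n * c) := by
  simp [leftMul]

theorem rightMul_single (m n : ι → ℤ) (c : k) :
    rightMul P n (Finsupp.single m c) = Finsupp.single (m + n) (cocycle P m n * c) := by
  simp [rightMul]

theorem rightMul_apply_add (n r : ι → ℤ) (f : (ι → ℤ) →₀ k) :
    rightMul P n f (r + n) = cocycle P r n * f r := by
  induction f using Finsupp.induction_linear with
  | zero => simp
  | add f g hf hg => simp [hf, hg, mul_add]
  | single m c =>
    rw [rightMul_single, Finsupp.single_apply, Finsupp.single_apply]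
    by_cases h : m = r
    · simp [h]
    · simp [h]

theorem leftMul_apply_add (n r : ι → ℤ) (f : (ι → ℤ) →₀ k) :
    leftMul P n f (n + r) = cocycle P n r * f r := by
  induction f using Finsupp.induction_linear with
  | zero => simp
  | add f g hf hg => simp [hf, hg, mul_add]
  | single m c =>
    rw [leftMul_single, Finsupp.single_apply, Finsupp.single_apply]
    by_cases h : m = r
    · simp [h]
    · simp [h]

/-- The commutant of the right multiplications. -/
def subalgebra : Subalgebra k (Module.End k ((ι → ℤ) →₀ k)) :=
  Subalgebra.centralizer k (Set.range (rightMul P))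

end QTorus

/-- The quantum torus with commutation matrix `P`, as the algebra of left multiplications. -/
abbrev QTorus {k ι : Type*} [Field k] [Fintype ι] (P : Matrix ι ι kˣ) : Type _ :=
  QTorus.subalgebra P

namespace QTorus

variable {k ι : Type*} [Field k] [Fintype ι] (P : Matrix ι ι kˣ)

instance : Ring (QTorus P) := Algebra.semiringToRing k

/-- The monomial with exponent `m`. -/
def mono (m : ι → ℤ) : QTorus P := ⟨leftMul P m, by
  rw [subalgebra, Subalgebra.mem_centralizer_iff]
  rintro _ ⟨n, rfl⟩
  refine Finsupp.lhom_ext fun r c => ?_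
  simp only [Module.End.mul_apply, leftMul_single, rightMul_single, cocycle_add_left,
    cocycle_add_right, Units.val_mul, add_assoc]
  congr 1
  ring⟩

variable {P}

/-- The coefficients of an element of the quantum torus. -/
def coeff : QTorus P →ₗ[k] ((ι → ℤ) →₀ k) where
  toFun f := f.1 (Finsupp.single 0 1)
  map_add' _ _ := rfl
  map_smul' _ _ := rfl

/-- An operator that commutes with right multiplications is determined by its value at the unit
monomial. The product of the torus is composition, so associativity is free, and this formula gives
access to coefficients. -/
theorem apply_single (f : QTorus P) (n : ι → ℤ) :
    f.1 (Finsupp.single n 1) = rightMul P n (coeff f) := by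
  have h := (Subalgebra.mem_centralizer_iff k).1 f.2 _ ⟨n, rfl⟩
  have h' := LinearMap.congr_fun h (Finsupp.single 0 1)
  simp only [Module.End.mul_apply, rightMul_single, cocycle_zero_left] at h'
  simpa [coeff] using h'.symm

theorem coeff_injective : Function.Injective (coeff : QTorus P →ₗ[k] _) := by
  intro f g h
  refine Subtype.ext (Finsupp.lhom_ext fun n c => ?_)
  have : Finsupp.single n c = c • Finsupp.single n (1 : k) := by simp
  rw [this, map_smul, map_smul, apply_single, apply_single, h]

theorem eq_zero_of_coeff {f : QTorus P} (h : ∀ m, coeff f m = 0) : f = 0 :=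
  coeff_injective (by ext m; simp [h])

theorem exists_coeff_ne_zero {f : QTorus P} (h : f ≠ 0) : ∃ m, coeff f m ≠ 0 := by
  by_contra! h'
  exact h (eq_zero_of_coeff h')

theorem coeff_mono (m : ι → ℤ) : coeff (mono P m) = Finsupp.single m 1 := by
  change leftMul P m _ = _
  simp [leftMul_single, cocycle_zero_right]

theorem coeff_mono_mul (n r : ι → ℤ) (f : QTorus P) :
    coeff (mono P n * f) (n + r) = cocycle P n r * coeff f r :=
  leftMul_apply_add P n r _

theorem coeff_mul_mono (n r : ι → ℤ) (f : QTorus P) :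
    coeff (f * mono P n) (r + n) = cocycle P r n * coeff f r := by
  rw [← rightMul_apply_add, ← apply_single]
  change f.1 (leftMul P n (Finsupp.single 0 1)) _ = _
  simp [leftMul_single, cocycle_zero_right]

theorem mono_mul_mono (m n : ι → ℤ) :
    mono P m * mono P n = (cocycle P m n : k) • mono P (m + n) := by
  apply coeff_injective
  ext r
  obtain ⟨r, rfl⟩ : ∃ r', r = m + r' := ⟨r - m, by simp⟩
  rw [coeff_mono_mul, map_smul, coeff_mono, coeff_mono]
  by_cases h : n = r
  · simp [h]
  · simp [h]

theorem mono_zero : mono P 0 = 1 := by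
  apply coeff_injective
  rw [coeff_mono]
  rfl

theorem coeff_one : coeff (1 : QTorus P) = Finsupp.single 0 1 := by
  rw [← mono_zero, coeff_mono]

theorem mono_mul_comm (m n : ι → ℤ) :
    mono P m * mono P n = (comm P m n : k) • (mono P n * mono P m) := by
  rw [mono_mul_mono, mono_mul_mono, smul_smul, cocycle_eq_comm_mul, Units.val_mul, add_comm m]

theorem coeff_mul (f g : QTorus P) (r : ι → ℤ) :
    coeff (f * g) r =
      (coeff g).sum fun n c => cocycle P (r - n) n * coeff f (r - n) * c := by
  have h : coeff (f * g) = f.1 (coeff g) := rfl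
  rw [h]
  conv_lhs => rw [← Finsupp.sum_single (coeff g)]
  rw [map_finsuppSum, Finsupp.sum_apply]
  refine Finsupp.sum_congr fun n _ => ?_
  have e : Finsupp.single n (coeff g n) = coeff g n • Finsupp.single n (1 : k) := by simp
  rw [e, map_smul, apply_single, Finsupp.smul_apply, smul_eq_mul, mul_comm]
  congr 1
  conv_lhs => rw [← sub_add_cancel r n]
  rw [rightMul_apply_add]

theorem exists_of_coeff_mul_ne_zero {f g : QTorus P} {r : ι → ℤ} (h : coeff (f * g) r ≠ 0) :
    ∃ m n, coeff f m ≠ 0 ∧ coeff g n ≠ 0 ∧ m + n = r := by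
  rw [coeff_mul] at h
  obtain ⟨n, hn, h'⟩ := Finset.exists_ne_zero_of_sum_ne_zero h
  refine ⟨r - n, n, fun h0 => ?_, by simpa using hn, by simp⟩
  simp [h0] at h'

/-- If `(m, n)` is the only pair of exponents of `f`, `g` with sum `m + n`, then the coefficient
of `f * g` at `m + n` is the expected one. -/
theorem coeff_mul_of_unique (f g : QTorus P) (m n : ι → ℤ)
    (h : ∀ m' n', coeff f m' ≠ 0 → coeff g n' ≠ 0 → m' + n' = m + n → n' = n) :
    coeff (f * g) (m + n) = cocycle P m n * coeff f m * coeff g n := by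
  rw [coeff_mul, Finsupp.sum, Finset.sum_eq_single n]
  · simp
  · intro n' hn' hne
    by_cases h0 : coeff f (m + n - n') = 0
    · simp [h0]
    · exact absurd (h _ _ h0 (by simpa using hn') (by simp)) hne
  · intro hn
    simp [Finsupp.notMem_support_iff.1 hn]

/-- Multiplication by a monomial shifts exponents without cancellation, so q-commutation with a
monomial is a condition on each exponent of `f` separately. -/
theorem comm_eq_of_mul_mono {f : QTorus P} {n : ι → ℤ} {c : kˣ}
    (h : f * mono P n = (c : k) • (mono P n * f)) {m : ι → ℤ} (hm : coeff f m ≠ 0) :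
    comm P m n = c := by
  have h' := DFunLike.congr_fun (congrArg coeff h) (m + n)
  rw [coeff_mul_mono, map_smul, Finsupp.smul_apply, add_comm m n, coeff_mono_mul, smul_eq_mul,
    ← mul_assoc] at h'
  have h2 := mul_right_cancel₀ hm h'
  rw [comm, mul_inv_eq_iff_eq_mul]
  exact Units.ext (by simpa using h2)

end QTorus

/-! ### Nonvanishing of `x_l`, and a Hopf ideal that contains it -/

namespace Bosonization

variable {k G : Type*} [Field k] [CommGroup G] {θ : ℕ} (D : QLSDatum k G θ)

/-- A two-dimensional representation detects `x_l`: it acts by a nilpotent matrix unit, the other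
`x_i` by zero, and `h ∈ G` by `diag(χ_l(h), 1)`. The power relation holds because `m_l ≥ 2`. -/
theorem x_ne_zero (l : Fin θ) : x D l ≠ 0 := by
  intro h
  have hm := D.two_le_order l
  let E : Matrix (Fin 2) (Fin 2) k := !![0, 1; 0, 0]
  have hE : E * E = 0 := by
    ext i j
    fin_cases i <;> fin_cases j <;> simp [E, Matrix.mul_apply, Fin.sum_univ_two]
  let f := lift D (R := Matrix (Fin 2) (Fin 2) k) (fun h => !![(D.χ l h : k), 0; 0, 1])
    (fun i => if i = l then E else 0)
    (by
      ext i j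
      fin_cases i <;> fin_cases j <;> simp)
    (by
      intro a b
      ext i j
      fin_cases i <;> fin_cases j <;> simp [Matrix.mul_apply, Fin.sum_univ_two])
    (by
      intro i
      by_cases hi : i = l
      · subst hi
        obtain ⟨r, hr⟩ : ∃ r, D.m i = 2 + r := ⟨D.m i - 2, by unfold QLSDatum.m; omega⟩
        rw [if_pos rfl, hr, pow_add, pow_two, hE, zero_mul]
      · rw [if_neg hi, zero_pow (m_pos D i).ne'])
    (by
      intro i j hij
      by_cases hi : i = l
      · subst hi
        simp [hij.symm]
      · simp [hi])
    (by
      intro a i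
      by_cases hi : i = l
      · subst hi
        ext i j
        fin_cases i <;> fin_cases j <;> simp [E, Matrix.mul_apply, Fin.sum_univ_two]
      · simp [hi])
  have hf : f (x D l) = E := by
    simp only [f]
    rw [lift_x, if_pos rfl]
  rw [h, map_zero] at hf
  have := congrFun (congrFun hf 0) 1
  simp [E] at this

/-- The endomorphism of `B` that sends `x_l` to zero and fixes the other generators. -/
def killX (l : Fin θ) : Bosonization D →ₐ[k] Bosonization D :=
  lift D (grp D) (fun i => if i = l then 0 else x D i) (grp_one D) (grp_mul D)
    (by
      intro i
      split_ifs
      · exact zero_pow (m_pos D i).ne'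
      · exact x_pow D i)
    (by
      intro i j hij
      split_ifs <;> simp [x_mul_x D i j hij])
    (by
      intro a i
      split_ifs <;> simp [grp_mul_x])

theorem killX_grp (l : Fin θ) (a : G) : killX D l (grp D a) = grp D a := by
  unfold killX
  rw [lift_grp]

theorem killX_x (l i : Fin θ) : killX D l (x D i) = if i = l then 0 else x D i := by
  unfold killX
  rw [lift_x]

theorem killX_killX (l : Fin θ) (a : Bosonization D) :
    killX D l (killX D l a) = killX D l a := by
  have : (killX D l).comp (killX D l) = killX D l := by
    apply algHom_ext
    · intro a
      simp [killX_grp]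
    · intro i
      by_cases h : i = l <;> simp [killX_x, h]
  exact DFunLike.congr_fun this a

theorem comulHom_killX (l : Fin θ) (a : Bosonization D) :
    comulHom D (killX D l a) =
      Algebra.TensorProduct.map (killX D l) (killX D l) (comulHom D a) := by
  have : (comulHom D).comp (killX D l) =
      (Algebra.TensorProduct.map (killX D l) (killX D l)).comp (comulHom D) := by
    apply algHom_ext
    · intro a
      simp [killX_grp, comulHom_grp]
    · intro i
      by_cases h : i = l <;> simp [killX_x, killX_grp, comulHom_x, h]
  exact DFunLike.congr_fun this a

theorem counitHom_killX (l : Fin θ) (a : Bosonization D) :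
    counitHom D (killX D l a) = counitHom D a := by
  have : (counitHom D).comp (killX D l) = counitHom D := by
    apply algHom_ext
    · intro a
      simp [killX_grp]
    · intro i
      by_cases h : i = l <;> simp [killX_x, counitHom_x, h]
  exact DFunLike.congr_fun this a

theorem antipodeLin_killX (l : Fin θ) (a : Bosonization D) :
    antipodeLin D (killX D l a) = killX D l (antipodeLin D a) := by
  induction a using induction with
  | hs c => simp [antipodeLin_algebraMap]
  | hg a => simp [killX_grp, antipodeLin_grp]
  | hx i => by_cases h : i = l <;> simp [killX_x, killX_grp, antipodeLin_x, h]
  | hmul a b ha hb => simp [antipodeLin_mul, ha, hb]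
  | hadd a b ha hb => simp [ha, hb]

/-- `killX` is an idempotent Hopf endomorphism. By idempotence the quotient map by its kernel
factors through it, so the comultiplication of a kernel element may be replaced by that of its
image, which is zero. -/
theorem isHopfIdeal_ker_killX (l : Fin θ) :
    (RingHom.ker (killX D l)).IsHopfIdeal k where
  counit_eq_zero := by
    intro a ha
    rw [counit_eq, ← counitHom_killX D l, show killX D l a = 0 from ha, map_zero]
  map_mkQ_comul_eq_zero := by
    intro a ha
    set I := (RingHom.ker (killX D l)).restrictScalars k
    have hI : I.mkQ ∘ₗ (killX D l).toLinearMap = I.mkQ := by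
      ext b
      refine (Submodule.Quotient.eq I).2 ?_
      change killX D l (killX D l b - b) = 0
      rw [map_sub, killX_killX, sub_self]
    have h := comulHom_killX D l a
    rw [show killX D l a = 0 from ha, map_zero] at h
    change TensorProduct.map I.mkQ I.mkQ (comulHom D a) = 0
    rw [← hI, TensorProduct.map_comp, LinearMap.comp_apply]
    exact (congrArg (TensorProduct.map I.mkQ I.mkQ) h.symm).trans (map_zero _)
  antipode_mem := by
    intro a ha
    change killX D l (antipodeLin D a) = 0
    rw [← antipodeLin_killX, show killX D l a = 0 from ha, map_zero]

end Bosonization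

/-! ### Actions of the generators: automorphisms and skew derivations -/

namespace HopfAction

variable {k G A : Type*} [Field k] [CommGroup G] {θ : ℕ} {D : QLSDatum k G θ}
  [Ring A] [Algebra k A] (ρ : HopfAction k (Bosonization D) A)

open Bosonization

/-- If `x_l` acted as zero, the action would factor through `killX D l`, whose kernel is a Hopf
ideal containing the nonzero element `x_l`. -/
theorem act_x_ne_zero (hρ : ρ.InnerFaithful) (l : Fin θ) : ρ.act (x D l) ≠ 0 := by
  intro h0
  have hc : ρ.act.comp (killX D l) = ρ.act := by
    apply algHom_ext
    · intro a
      simp [killX_grp]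
    · intro i
      by_cases h : i = l
      · subst h
        simp [killX_x, h0]
      · simp [killX_x, h]
  have hI := hρ (RingHom.ker (killX D l)) inferInstance (isHopfIdeal_ker_killX D l) (by
    intro h hh a
    rw [← hc, AlgHom.comp_apply, show killX D l h = 0 from hh, map_zero, LinearMap.zero_apply])
  have hx : x D l ∈ RingHom.ker (killX D l) := by
    rw [RingHom.mem_ker, killX_x, if_pos rfl]
  rw [hI, Ideal.mem_bot] at hx
  exact x_ne_zero D l hx

theorem act_grp_one (h : G) : ρ.act (grp D h) 1 = 1 := by
  rw [ρ.act_one, counit_eq, counitHom_grp, map_one]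

theorem act_grp_mul (h : G) (a b : A) :
    ρ.act (grp D h) (a * b) = ρ.act (grp D h) a * ρ.act (grp D h) b := by
  rw [ρ.act_mul, comul_eq, comulHom_grp]
  simp

theorem act_grp_inv (h : G) (a : A) : ρ.act (grp D h⁻¹) (ρ.act (grp D h) a) = a := by
  rw [← Module.End.mul_apply, ← map_mul, grp_inv_mul, map_one, Module.End.one_apply]

/-- The automorphism of `A` given by `h ∈ G`. -/
def grpHom (h : G) : A →ₐ[k] A :=
  AlgHom.ofLinearMap (ρ.act (grp D h)) (ρ.act_grp_one h) (ρ.act_grp_mul h)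

theorem grpHom_inv (h : G) (a : A) : ρ.grpHom h⁻¹ (ρ.grpHom h a) = a := ρ.act_grp_inv h a

theorem act_x_one (l : Fin θ) : ρ.act (x D l) 1 = 0 := by
  rw [ρ.act_one, counit_eq, counitHom_x, map_zero]

theorem act_x_mul (l : Fin θ) (a b : A) :
    ρ.act (x D l) (a * b) =
      ρ.grpHom (D.g l) a * ρ.act (x D l) b + ρ.act (x D l) a * b := by
  rw [ρ.act_mul, comul_eq, comulHom_x]
  simp [grpHom]

theorem grpHom_act_x (h : G) (l : Fin θ) (a : A) :
    ρ.grpHom h (ρ.act (x D l) a) = (D.χ l h : k) • ρ.act (x D l) (ρ.grpHom h a) := by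
  change (ρ.act (grp D h) * ρ.act (x D l)) a = _
  rw [← map_mul, grp_mul_x, map_smul, map_mul]
  rfl

end HopfAction

/-! ### Linearity of q-commutation -/

namespace QTorus

variable {k ι : Type*} [Field k] [Fintype ι] {P : Matrix ι ι kˣ} {c : k} {f f' g g' : QTorus P}

theorem qcommute_sub_left (h : f * g = c • (g * f)) (h' : f' * g = c • (g * f')) :
    (f - f') * g = c • (g * (f - f')) := by
  rw [sub_mul, mul_sub, smul_sub, h, h']

theorem qcommute_sub_right (h : f * g = c • (g * f)) (h' : f * g' = c • (g' * f)) :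
    f * (g - g') = c • ((g - g') * f) := by
  rw [sub_mul, mul_sub, smul_sub, h, h']

theorem qcommute_smul_left (a : k) (h : f * g = c • (g * f)) :
    (a • f) * g = c • (g * (a • f)) := by
  rw [smul_mul_assoc, h, mul_smul_comm, smul_comm]

theorem qcommute_smul_right (a : k) (h : f * g = c • (g * f)) :
    f * (a • g) = c • ((a • g) * f) := by
  rw [smul_mul_assoc, mul_smul_comm, h, smul_comm]

end QTorus

/-! ### The homomorphism from the quantized Weyl algebra to a quantum torus -/

namespace QWeyl

open QTorus

variable {k : Type*} [Field k] {t : ℕ} (p : Matrix (Fin t) (Fin t) kˣ) (γ : Fin t → kˣ)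

/-- The index of a letter. -/
def idx : Letter t → Fin t
  | .inl i => i
  | .inr i => i

/-- The matrix of the quantum torus with generators `zᵢ` (letters `.inl i`) and `vᵢ` (letters
`.inr i`). -/
def torusMatrix : Matrix (Letter t) (Letter t) kˣ
  -- The letter `.inl l` is `z_{l+1}`, which involves `v_i u_i` exactly for `i ≤ l`. Only one entry
  -- of each transposed pair is nontrivial, which makes the cocycle trivial on the products needed
  -- below.
  | .inl l, .inr i => if i ≤ l then γ i else 1
  | .inr j, .inr i => if i < j then p j i else 1
  | _, .inl _ => 1

/-- The exponent of `vᵢ`. -/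
def eps (i : Fin t) : Letter t → ℤ := Pi.single (.inr i) 1

/-- The exponent of the normal element `1 + ∑_{l < n} (γ_l - 1) v_l u_l`. -/
def zeta (t n : ℕ) : Letter t → ℤ
  -- `z_n` is the torus letter of index `n - 1`; `z_0 = 1` has exponent `0`.
  | .inl i => if (i : ℕ) + 1 = n then 1 else 0
  | .inr _ => 0

/-- The leading exponents of the generators. -/
def ex : Letter t → Letter t → ℤ
  | .inl i => zeta t (i + 1) - eps i
  | .inr i => eps i

theorem zeta_zero : zeta t 0 = 0 := by
  ext a
  cases a <;> simp [zeta]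

theorem zeta_succ (i : Fin t) : zeta t (i + 1) = Pi.single (.inl i) 1 := by
  ext a
  cases a with
  | inl j => simp [zeta, Pi.single_apply, Fin.ext_iff]
  | inr j => simp [zeta]

theorem zeta_eq (n : ℕ) (hn : n ≤ t) : zeta t n = 0 ∨
    ∃ i : Fin t, n = i + 1 ∧ zeta t n = Pi.single (.inl i) 1 := by
  cases n with
  | zero => exact .inl zeta_zero
  | succ n => exact .inr ⟨⟨n, hn⟩, rfl, zeta_succ ⟨n, hn⟩⟩

theorem zeta_inr (n : ℕ) (i : Fin t) : zeta t n (.inr i) = 0 := rfl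

theorem eps_inl (i j : Fin t) : eps i (.inl j) = 0 := by simp [eps]

theorem eps_inr (i j : Fin t) : eps i (.inr j) = if j = i then 1 else 0 := by
  simp [eps, Pi.single_apply]

variable {p γ}

theorem cocycle_eps_eps_self (i : Fin t) : cocycle (torusMatrix p γ) (eps i) (eps i) = 1 := by
  simp [eps, cocycle_single_single, torusMatrix]

theorem cocycle_eps_zeta (i : Fin t) (n : ℕ) (hn : n ≤ t) :
    cocycle (torusMatrix p γ) (eps i) (zeta t n) = 1 := by
  obtain h | ⟨j, -, h⟩ := zeta_eq n hn
  · rw [h, cocycle_zero_right]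
  · rw [h, eps, cocycle_single_single, torusMatrix]

/-- Ensures that `v_i` times the monomial with exponent `zeta t n - eps i` is the monomial of `z_n`
without a scalar. -/
theorem cocycle_eps_sub (i : Fin t) (n : ℕ) (hn : n ≤ t) :
    cocycle (torusMatrix p γ) (eps i) (zeta t n - eps i) = 1 := by
  have h := cocycle_add_right (torusMatrix p γ) (eps i) (zeta t n - eps i) (eps i)
  rw [sub_add_cancel, cocycle_eps_zeta i n hn, cocycle_eps_eps_self, mul_one] at h
  exact h.symm

theorem comm_eps_eps (hp : IsMulAntisymm p) (i j : Fin t) :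
    comm (torusMatrix p γ) (eps i) (eps j) = p i j := by
  rw [eps, eps, comm_single_single]
  rcases lt_trichotomy i j with h | rfl | h
  · simp [torusMatrix, h, h.not_gt, hp.2 i j]
  · simp [torusMatrix, hp.1]
  · simp [torusMatrix, h, h.not_gt]

theorem comm_zeta_eps (n : ℕ) (hn : n ≤ t) (i : Fin t) :
    comm (torusMatrix p γ) (zeta t n) (eps i) = if (i : ℕ) < n then γ i else 1 := by
  obtain rfl | n := n
  · simp [zeta_zero, comm_zero_left]
  · have e := zeta_succ (⟨n, hn⟩ : Fin t)
    simp only at e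
    rw [e, eps, comm_single_single]
    simp [torusMatrix, Fin.le_def]

theorem comm_zeta_zeta (n m : ℕ) (hn : n ≤ t) (hm : m ≤ t) :
    comm (torusMatrix p γ) (zeta t n) (zeta t m) = 1 := by
  obtain h | ⟨i, -, h⟩ := zeta_eq n hn
  · rw [h, comm_zero_left]
  obtain h' | ⟨j, -, h'⟩ := zeta_eq m hm
  · rw [h', comm_zero_right]
  rw [h, h', comm_single_single]
  simp [torusMatrix]

theorem comm_eps_zeta (n : ℕ) (hn : n ≤ t) (i : Fin t) :
    comm (torusMatrix p γ) (eps i) (zeta t n) = if (i : ℕ) < n then (γ i)⁻¹ else 1 := by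
  rw [comm_swap, comm_zeta_eps n hn]
  split_ifs <;> simp

/-- The commutation scalar of the leading monomials of two generators. -/
abbrev lcomm (p : Matrix (Fin t) (Fin t) kˣ) (γ : Fin t → kˣ) (a b : Letter t) : kˣ :=
  comm (torusMatrix p γ) (ex a) (ex b)

theorem lcomm_inl_inr (hp : IsMulAntisymm p) (i j : Fin t) :
    lcomm p γ (.inl i) (.inr j) = (if j ≤ i then γ j else 1) * p j i := by
  simp only [lcomm, ex, comm_sub_left, comm_eps_eps hp, comm_zeta_eps _ i.2]
  rw [hp.2 j i]
  simp only [Fin.le_def, Nat.lt_succ_iff]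

theorem lcomm_inl_inl (hp : IsMulAntisymm p) (i j : Fin t) (h : i < j) :
    lcomm p γ (.inl i) (.inl j) = γ i * p i j := by
  simp only [lcomm, ex, comm_sub_left, comm_sub_right, comm_eps_eps hp, comm_zeta_eps _ i.2,
    comm_zeta_zeta _ _ i.2 j.2, comm_eps_zeta _ j.2]
  have h1 : ¬ (j : ℕ) < i + 1 := by
    have := Fin.lt_def.1 h
    omega
  have h2 : (i : ℕ) < j + 1 := by
    have := Fin.lt_def.1 h
    omega
  simp [h1, h2, mul_comm]

theorem lcomm_inr_inr (hp : IsMulAntisymm p) (i j : Fin t) :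
    lcomm p γ (.inr i) (.inr j) = p i j := comm_eps_eps hp i j

/-- Among the `v_l`, only `v_i` distinguishes `z_i` from `z_{i+1}`. Hence the two monomials of `u_i`
have the same commutation scalars with letters of other index. -/
theorem comm_zeta_succ (i l : Fin t) (h : l ≠ i) :
    comm (torusMatrix p γ) (zeta t i) (eps l) = comm (torusMatrix p γ) (zeta t (i + 1)) (eps l) := by
  rw [comm_zeta_eps _ i.2.le, comm_zeta_eps _ i.2]
  have : (l : ℕ) ≠ i := fun e => h (Fin.ext e)
  have : (l : ℕ) < i ↔ (l : ℕ) < i + 1 := by omega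
  simp [this]

/-- The normal elements `1 + ∑_{l < n} (γ_l - 1) v_l u_l`. -/
def z (p : Matrix (Fin t) (Fin t) kˣ) (γ : Fin t → kˣ) (n : ℕ) : QWeyl p γ :=
  1 + ∑ l ∈ Finset.univ.filter (fun l : Fin t => (l : ℕ) < n),
    ((γ l : k) - 1) • (gen p γ (.inr l) * gen p γ (.inl l))

theorem filter_val_lt_succ (n : ℕ) (hn : n < t) :
    Finset.univ.filter (fun l : Fin t => (l : ℕ) < n + 1) =
      insert ⟨n, hn⟩ (Finset.univ.filter (fun l : Fin t => (l : ℕ) < n)) := by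
  ext l
  simp [Fin.ext_iff]
  omega

/-- The quotient map from the free algebra. -/
def mk (p : Matrix (Fin t) (Fin t) kˣ) (γ : Fin t → kˣ) :
    FreeAlgebra k (Letter t) →ₐ[k] QWeyl p γ := RingQuot.mkAlgHom k (Rel p γ)

theorem mk_rel {a b : FreeAlgebra k (Letter t)} (h : Rel p γ a b) : mk p γ a = mk p γ b :=
  RingQuot.mkAlgHom_rel k h

theorem mk_ι (a : Letter t) : mk p γ (FreeAlgebra.ι k a) = gen p γ a := rfl

theorem gen_inl_mul_inr_self (i : Fin t) :
    gen p γ (.inl i) * gen p γ (.inr i) =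
      z p γ i + (γ i : k) • (gen p γ (.inr i) * gen p γ (.inl i)) := by
  have h := mk_rel (Rel.uv (p := p) (γ := γ) i)
  simp only [map_mul, map_add, map_one, map_smul, map_sum, mk_ι] at h
  refine Eq.trans h ?_
  rw [z, add_right_comm]
  rfl

theorem qcommute_symm {R : Type*} [Ring R] [Algebra k R] {c : kˣ} {f g : R}
    (h : f * g = (c : k) • (g * f)) : g * f = ((c⁻¹ : kˣ) : k) • (f * g) := by
  rw [h, smul_smul, ← Units.val_mul, inv_mul_cancel, Units.val_one, one_smul]

/-- Puts all relations between letters of different index into one form, whose scalar is read off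
from the leading exponents. -/
theorem gen_mul_gen (hp : IsMulAntisymm p) (a b : Letter t) (h : idx a ≠ idx b) :
    gen p γ a * gen p γ b = (lcomm p γ a b : k) • (gen p γ b * gen p γ a) := by
  have hlr : ∀ i j : Fin t, i ≠ j → gen p γ (.inl i) * gen p γ (.inr j) =
      (lcomm p γ (.inl i) (.inr j) : k) • (gen p γ (.inr j) * gen p γ (.inl i)) := by
    intro i j hij
    rw [lcomm_inl_inr hp]
    rcases lt_or_gt_of_ne hij with h | h
    · simpa [h.not_ge, mk_ι] using mk_rel (Rel.uv_lt (p := p) (γ := γ) i j h)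
    · simpa [h.le, mk_ι] using mk_rel (Rel.uv_gt (p := p) (γ := γ) i j h)
  have hll : ∀ i j : Fin t, i < j → gen p γ (.inl i) * gen p γ (.inl j) =
      (lcomm p γ (.inl i) (.inl j) : k) • (gen p γ (.inl j) * gen p γ (.inl i)) := by
    intro i j hij
    rw [lcomm_inl_inl hp _ _ hij]
    simpa [mk_ι] using mk_rel (Rel.uu (p := p) (γ := γ) i j hij)
  cases a with
  | inl i => cases b with
    | inl j =>
      rcases lt_or_gt_of_ne h with h | h
      · exact hll i j h
      · rw [lcomm, comm_swap]
        exact qcommute_symm (hll j i h)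
    | inr j => exact hlr i j h
  | inr i => cases b with
    | inl j =>
      rw [lcomm, comm_swap]
      exact qcommute_symm (hlr j i h.symm)
    | inr j =>
      rw [lcomm_inr_inr hp]
      simpa [mk_ι] using mk_rel (Rel.vv (p := p) (γ := γ) i j)

theorem induction {Q : QWeyl p γ → Prop} (hs : ∀ c : k, Q (algebraMap k _ c))
    (hg : ∀ a, Q (gen p γ a)) (hmul : ∀ a b, Q a → Q b → Q (a * b))
    (hadd : ∀ a b, Q a → Q b → Q (a + b)) (a : QWeyl p γ) : Q a := by
  obtain ⟨a, rfl⟩ : ∃ b, mk p γ b = a := RingQuot.mkAlgHom_surjective k (Rel p γ) a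
  induction a using FreeAlgebra.induction with
  | grade0 r => simpa using hs r
  | grade1 z => exact hg z
  | mul a b ha hb => simpa using hmul _ _ ha hb
  | add a b ha hb => simpa using hadd _ _ ha hb

/-- The images of the generators in the quantum torus. -/
def torusGen (p : Matrix (Fin t) (Fin t) kˣ) (γ : Fin t → kˣ) : Letter t → QTorus (torusMatrix p γ)
  | .inl i => ((γ i : k) - 1)⁻¹ •
      (mono (torusMatrix p γ) (zeta t (i + 1) - eps i) - mono (torusMatrix p γ) (zeta t i - eps i))
  | .inr i => mono (torusMatrix p γ) (eps i)

theorem torusGen_inr_mul_inl (i : Fin t) :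
    torusGen p γ (.inr i) * torusGen p γ (.inl i) =
      ((γ i : k) - 1)⁻¹ •
        (mono (torusMatrix p γ) (zeta t (i + 1)) - mono (torusMatrix p γ) (zeta t i)) := by
  rw [torusGen, torusGen, mul_smul_comm, mul_sub, mono_mul_mono, mono_mul_mono,
    cocycle_eps_sub _ _ i.2, cocycle_eps_sub _ _ i.2.le]
  simp

theorem comm_ex_low (a : Letter t) (i : Fin t) (h : idx a ≠ i) :
    comm (torusMatrix p γ) (ex a) (zeta t i - eps i) = lcomm p γ a (.inl i) := by
  cases a with
  | inl j =>
    simp only [lcomm, ex, comm_sub_right, comm_sub_left, comm_zeta_zeta _ _ j.2 i.2,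
      comm_zeta_zeta _ _ j.2 i.2.le]
    rw [comm_swap _ (eps j) (zeta t i), comm_swap _ (eps j) (zeta t (i + 1)),
      comm_zeta_succ i j h]
  | inr j =>
    simp only [lcomm, ex, comm_sub_right]
    rw [comm_swap _ (eps j) (zeta t i), comm_swap _ (eps j) (zeta t (i + 1)),
      comm_zeta_succ i j h]

theorem comm_low_low (i j : Fin t) (h : i ≠ j) :
    comm (torusMatrix p γ) (zeta t i - eps i) (zeta t j - eps j) =
      lcomm p γ (.inl i) (.inl j) := by
  simp only [lcomm, ex, comm_sub_right, comm_sub_left, comm_zeta_zeta _ _ i.2 j.2,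
    comm_zeta_zeta _ _ i.2.le j.2.le]
  rw [comm_swap _ (eps i) (zeta t j), comm_swap _ (eps i) (zeta t (j + 1)),
    comm_zeta_succ i j h.symm, comm_zeta_succ j i h]

theorem torusGen_mul_torusGen (a b : Letter t) (h : idx a ≠ idx b) :
    torusGen p γ a * torusGen p γ b =
      (lcomm p γ a b : k) • (torusGen p γ b * torusGen p γ a) := by
  have low : ∀ (i : Fin t) (b : Letter t), i ≠ idx b →
      comm (torusMatrix p γ) (zeta t i - eps i) (ex b) = lcomm p γ (.inl i) b := by
    intro i b hb
    rw [comm_swap, comm_ex_low b i hb.symm, lcomm, ← comm_swap]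
  have hexl : ∀ (a : Letter t) (j : Fin t), idx a ≠ j →
      mono (torusMatrix p γ) (ex a) * torusGen p γ (.inl j) =
        (lcomm p γ a (.inl j) : k) • (torusGen p γ (.inl j) * mono _ (ex a)) := by
    intro a j haj
    refine qcommute_smul_right _ (qcommute_sub_right (mono_mul_comm _ _) ?_)
    rw [← comm_ex_low a j haj]
    exact mono_mul_comm _ _
  cases b with
  | inr j => cases a with
    | inr i => exact mono_mul_comm _ _
    | inl i =>
      refine qcommute_smul_left _ (qcommute_sub_left (mono_mul_comm _ _) ?_)
      rw [← low i (.inr j) h]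
      exact mono_mul_comm _ _
  | inl j => cases a with
    | inr i => exact hexl (.inr i) j h
    | inl i =>
      refine qcommute_smul_left _ (qcommute_sub_left (hexl (.inl i) j h) ?_)
      refine qcommute_smul_right _ (qcommute_sub_right ?_ ?_)
      · rw [← low i (.inl j) h]
        exact mono_mul_comm _ _
      · rw [← comm_low_low i j h]
        exact mono_mul_comm _ _

/-- The sum telescopes: in the torus `(γ_l - 1) v_l u_l` is `z_{l+1} - z_l`. -/
theorem torus_z (hγ : ∀ i, (γ i : k) ≠ 1) (n : ℕ) (hn : n ≤ t) :
    1 + ∑ l ∈ Finset.univ.filter (fun l : Fin t => (l : ℕ) < n),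
      ((γ l : k) - 1) • (torusGen p γ (.inr l) * torusGen p γ (.inl l)) =
      mono (torusMatrix p γ) (zeta t n) := by
  induction n with
  | zero => simp [zeta_zero, mono_zero]
  | succ n ih =>
    rw [filter_val_lt_succ n hn, Finset.sum_insert (by simp), add_left_comm, ih (by omega),
      torusGen_inr_mul_inl, smul_smul, mul_inv_cancel₀ (sub_ne_zero.2 (hγ _)), one_smul]
    simp

/-- Moving `v_i` to the other side multiplies the `z_{i+1}` part by `γ_i` and the `z_i` part by `1`.
The discrepancy with `γ_i v_i u_i` is exactly `z_i`. -/
theorem torusGen_inl_mul_inr_self (hγ : ∀ i, (γ i : k) ≠ 1) (i : Fin t) :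
    torusGen p γ (.inl i) * torusGen p γ (.inr i) = mono (torusMatrix p γ) (zeta t i) +
      (γ i : k) • (torusGen p γ (.inr i) * torusGen p γ (.inl i)) := by
  have h0 := sub_ne_zero.2 (hγ i)
  have h1 : comm (torusMatrix p γ) (zeta t (i + 1) - eps i) (eps i) = γ i := by
    rw [comm_sub_left, comm_self, comm_zeta_eps _ i.2]
    simp
  have h2 : comm (torusMatrix p γ) (zeta t i - eps i) (eps i) = 1 := by
    rw [comm_sub_left, comm_self, comm_zeta_eps _ i.2.le]
    simp
  rw [torusGen_inr_mul_inl, torusGen, torusGen, smul_mul_assoc, sub_mul, mono_mul_comm, h1,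
    mono_mul_comm (zeta t i - eps i), h2, mono_mul_mono, mono_mul_mono, cocycle_eps_sub _ _ i.2,
    cocycle_eps_sub _ _ i.2.le]
  simp only [Units.val_one, one_smul, add_sub_cancel]
  match_scalars <;> field_simp
  ring

/-- The homomorphism to the quantum torus. -/
def toTorus (hp : IsMulAntisymm p) (hγ : ∀ i, (γ i : k) ≠ 1) :
    QWeyl p γ →ₐ[k] QTorus (torusMatrix p γ) :=
  RingQuot.liftAlgHom k ⟨FreeAlgebra.lift k (torusGen p γ), by
    intro a b h
    cases h with
    | vv i j =>
      rw [← comm_eps_eps (γ := γ) hp i j]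
      simpa [torusGen] using mono_mul_comm (eps i) (eps j)
    | uv_lt i j h =>
      have := torusGen_mul_torusGen (p := p) (γ := γ) (.inl i) (.inr j) h.ne
      rw [lcomm_inl_inr hp] at this
      simpa [h.not_ge] using this
    | uu i j h =>
      have := torusGen_mul_torusGen (p := p) (γ := γ) (.inl i) (.inl j) h.ne
      rw [lcomm_inl_inl hp _ _ h] at this
      simpa using this
    | uv_gt i j h =>
      have := torusGen_mul_torusGen (p := p) (γ := γ) (.inl i) (.inr j) h.ne'
      rw [lcomm_inl_inr hp] at this
      simpa [h.le] using this
    | uv j =>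
      simp only [map_mul, map_add, map_one, map_smul, map_sum, FreeAlgebra.lift_ι_apply]
      rw [torusGen_inl_mul_inr_self hγ, ← torus_z hγ _ j.2.le, add_right_comm]
      rfl⟩

theorem toTorus_gen (hp : IsMulAntisymm p) (hγ : ∀ i, (γ i : k) ≠ 1) (a : Letter t) :
    toTorus hp hγ (gen p γ a) = torusGen p γ a := by
  unfold toTorus gen
  exact (RingQuot.liftAlgHom_mkAlgHom_apply k _ _ _).trans (FreeAlgebra.lift_ι_apply _ _)

theorem toTorus_z (hp : IsMulAntisymm p) (hγ : ∀ i, (γ i : k) ≠ 1) (n : ℕ) (hn : n ≤ t) :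
    toTorus hp hγ (z p γ n) = mono (torusMatrix p γ) (zeta t n) := by
  rw [← torus_z hγ n hn, z]
  simp only [map_add, map_one, map_sum, map_smul, map_mul, toTorus_gen]

end QWeyl

/-! ### Lower subalgebras, the filtration, and exponents of lower index -/

namespace QWeyl

open QTorus

variable {k : Type*} [Field k] {t : ℕ} {p : Matrix (Fin t) (Fin t) kˣ} {γ : Fin t → kˣ}

instance : Nontrivial (QTorus (torusMatrix p γ)) := by
  refine ⟨⟨1, 0, fun h => ?_⟩⟩
  have := DFunLike.congr_fun (congrArg coeff h) 0
  simp [coeff_one] at this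

theorem coeff_torusGen_ex (hγ : ∀ i, (γ i : k) ≠ 1) (a : Letter t) :
    coeff (torusGen p γ a) (ex a) ≠ 0 := by
  cases a with
  | inr i => simp [torusGen, coeff_mono, ex]
  | inl i =>
    have h0 := sub_ne_zero.2 (hγ i)
    have h1 : zeta t i - eps i ≠ ex (.inl i) := by
      intro h
      have := congrFun h (.inl i)
      simp [ex, zeta, eps_inl] at this
    simp [torusGen, coeff_mono, Finsupp.single_apply, h1, h0]
    simp [ex]

theorem coeff_torusGen_ne_zero {a : Letter t} {m : Letter t → ℤ}
    (h : coeff (torusGen p γ a) m ≠ 0) :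
    m = ex a ∨ ∃ i, a = .inl i ∧ m = zeta t i - eps i := by
  cases a with
  | inr i =>
    left
    rw [torusGen, coeff_mono, Finsupp.single_apply] at h
    by_contra hm
    exact h (if_neg (Ne.symm hm))
  | inl i =>
    by_contra! hm
    apply h
    rw [torusGen, map_smul, map_sub, coeff_mono, coeff_mono, Finsupp.smul_apply,
      Finsupp.sub_apply, Finsupp.single_apply, Finsupp.single_apply,
      if_neg (Ne.symm (hm.2 i rfl)), if_neg (show ¬ zeta t (i + 1) - eps i = m from Ne.symm hm.1),
      sub_zero, smul_zero]

theorem comm_zeta_ex (n : ℕ) (b : Letter t) (h : n ≤ idx b) :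
    comm (torusMatrix p γ) (zeta t n) (ex b) = 1 := by
  cases b with
  | inr i =>
    change n ≤ (i : ℕ) at h
    rw [ex, comm_zeta_eps _ (h.trans i.2.le), if_neg (not_lt.2 h)]
  | inl i =>
    change n ≤ (i : ℕ) at h
    rw [ex, comm_sub_right, comm_zeta_eps _ (h.trans i.2.le), if_neg (not_lt.2 h),
      comm_zeta_zeta _ _ (h.trans i.2.le) i.2]
    simp

theorem ex_inl_add_inr (i : Fin t) : ex (.inl i) + ex (.inr i) = zeta t (i + 1) := by
  simp [ex]

/-- Each summand `v_l u_l` has the commutation scalars of `z_{l+1}`, and these are `1` with letters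
of index greater than `l`. -/
theorem commute_z_gen (hp : IsMulAntisymm p) (n : ℕ) (b : Letter t) (h : n ≤ idx b) :
    Commute (z p γ n) (gen p γ b) := by
  refine Commute.add_left (Commute.one_left _) (Commute.sum_left _ _ _ fun l hl => ?_)
  refine Commute.smul_left ?_ _
  have hl' : (l : ℕ) < idx b := lt_of_lt_of_le (by simpa using hl) h
  have hne : l ≠ idx b := fun e => by simp [e] at hl'
  have e : lcomm p γ (.inl l) b * lcomm p γ (.inr l) b = 1 := by
    rw [← comm_add_left, ex_inl_add_inr]
    exact comm_zeta_ex _ _ hl'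
  change _ * _ = _ * _
  rw [mul_assoc, gen_mul_gen hp (.inl l) b hne, mul_smul_comm, ← mul_assoc,
    gen_mul_gen hp (.inr l) b hne, smul_mul_assoc, smul_smul, ← Units.val_mul, e, Units.val_one,
    one_smul, mul_assoc]

/-- The subalgebra generated by the letters of index less than `n`. -/
def low (p : Matrix (Fin t) (Fin t) kˣ) (γ : Fin t → kˣ) (n : ℕ) : Subalgebra k (QWeyl p γ) :=
  Algebra.adjoin k {x | ∃ a, (idx a : ℕ) < n ∧ gen p γ a = x}

theorem gen_mem_low {n : ℕ} {a : Letter t} (h : (idx a : ℕ) < n) : gen p γ a ∈ low p γ n :=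
  Algebra.subset_adjoin ⟨a, h, rfl⟩

theorem low_mono {n n' : ℕ} (h : n ≤ n') : low p γ n ≤ low p γ n' :=
  Algebra.adjoin_mono fun _ ⟨a, ha, e⟩ => ⟨a, ha.trans_le h, e⟩

theorem z_mem_low (n : ℕ) : z p γ n ∈ low p γ n := by
  refine add_mem (one_mem _) (sum_mem fun l hl => Subalgebra.smul_mem _ (mul_mem ?_ ?_) _)
  · exact gen_mem_low (by simpa [idx] using hl)
  · exact gen_mem_low (by simpa [idx] using hl)

theorem low_top : low p γ t = ⊤ := by
  refine eq_top_iff.2 fun a _ => ?_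
  induction a using induction with
  | hs c => exact algebraMap_mem _ _
  | hg a => exact gen_mem_low (idx a).2
  | hmul a b ha hb => exact mul_mem (ha trivial) (hb trivial)
  | hadd a b ha hb => exact add_mem (ha trivial) (hb trivial)

theorem deg_eq (a : Letter t) : deg a = idx a + 1 := by cases a <;> rfl

/-- A letter of index at least `j` has degree at least `j + 1`. A word of degree at most `j + 1`
that contains one therefore consists of it alone, since every letter has positive degree. -/
theorem exists_of_mem_filtration {j : Fin t} {a : QWeyl p γ}
    (ha : a ∈ filtration p γ (j + 1)) : ∃ α β : k, ∃ c ∈ low p γ j,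
      a = α • gen p γ (.inl j) + β • gen p γ (.inr j) + c := by
  induction ha using Submodule.span_induction with
  | zero => exact ⟨0, 0, 0, zero_mem _, by simp⟩
  | add x y _ _ hx hy =>
    obtain ⟨α, β, c, hc, rfl⟩ := hx
    obtain ⟨α', β', c', hc', rfl⟩ := hy
    refine ⟨α + α', β + β', c + c', add_mem hc hc', ?_⟩
    module
  | smul s x _ hx =>
    obtain ⟨α, β, c, hc, rfl⟩ := hx
    refine ⟨s * α, s * β, s • c, Subalgebra.smul_mem _ hc _, ?_⟩
    module
  | mem x hx =>
    obtain ⟨w, hw, rfl⟩ := hx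
    by_cases h : ∀ b ∈ w, (idx b : ℕ) < j
    · refine ⟨0, 0, _, ?_, by simp; rfl⟩
      refine list_prod_mem fun x hx => ?_
      obtain ⟨b, hb, rfl⟩ := List.mem_map.1 hx
      exact gen_mem_low (h b hb)
    · push Not at h
      obtain ⟨b, hb, hj⟩ := h
      obtain ⟨s, r, rfl⟩ := List.append_of_mem hb
      simp only [List.map_append, List.map_cons, List.sum_append, List.sum_cons, deg_eq] at hw
      have hnil : ∀ l : List (Letter t), (l.map deg).sum = 0 → l = [] := by
        intro l hl
        cases l with
        | nil => rfl
        | cons b l => simp [deg_eq] at hl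
      obtain rfl := hnil s (by omega)
      obtain rfl := hnil r (by omega)
      have hij : idx b = j := Fin.ext (by simp at hw; omega)
      cases b with
      | inl i => exact ⟨1, 0, 0, zero_mem _, by simp [← hij, idx]⟩
      | inr i => exact ⟨0, 1, 0, zero_mem _, by simp [← hij, idx]⟩

/-- Exponents that involve only letters of index less than `n`. -/
def IsLow (n : ℕ) (m : Letter t → ℤ) : Prop := ∀ a, n ≤ idx a → m a = 0

theorem IsLow.add {n : ℕ} {m m' : Letter t → ℤ} (h : IsLow n m) (h' : IsLow n m') :
    IsLow n (m + m') := fun a ha => by simp [h a ha, h' a ha]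

theorem isLow_zero {n : ℕ} : IsLow n (0 : Letter t → ℤ) := fun _ _ => rfl

theorem isLow_zeta {n l : ℕ} (h : l ≤ n) : IsLow n (zeta t l) := by
  intro a ha
  cases a with
  | inl i =>
    have : ¬ (i : ℕ) + 1 = l := by
      simp only [idx] at ha
      omega
    simp [zeta, this]
  | inr i => rfl

theorem isLow_eps {n : ℕ} {i : Fin t} (h : (i : ℕ) < n) : IsLow n (eps i) := by
  intro a ha
  cases a with
  | inl j => exact eps_inl i j
  | inr j =>
    have : j ≠ i := fun e => by
      subst e
      exact absurd ha (not_le.2 h)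
    simp [eps_inr, this]

theorem IsLow.sub {n : ℕ} {m m' : Letter t → ℤ} (h : IsLow n m) (h' : IsLow n m') :
    IsLow n (m - m') := fun a ha => by simp [h a ha, h' a ha]

theorem IsLow.mono {n n' : ℕ} {m : Letter t → ℤ} (h : IsLow n m) (hn : n ≤ n') : IsLow n' m :=
  fun a ha => h a (hn.trans ha)

theorem isLow_ex {n : ℕ} {a : Letter t} (h : (idx a : ℕ) < n) : IsLow n (ex a) := by
  cases a with
  | inl i => exact (isLow_zeta h).sub (isLow_eps h)
  | inr i => exact isLow_eps h

theorem isLow_of_mem_low (hp : IsMulAntisymm p) (hγ : ∀ i, (γ i : k) ≠ 1) {n : ℕ}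
    {c : QWeyl p γ} (hc : c ∈ low p γ n) {m : Letter t → ℤ}
    (hm : coeff (toTorus hp hγ c) m ≠ 0) : IsLow n m := by
  induction hc using Algebra.adjoin_induction generalizing m with
  | mem x hx =>
    obtain ⟨a, ha, rfl⟩ := hx
    rw [toTorus_gen] at hm
    obtain rfl | ⟨i, rfl, rfl⟩ := coeff_torusGen_ne_zero hm
    · exact isLow_ex ha
    · exact (isLow_zeta (le_of_lt ha)).sub (isLow_eps ha)
  | algebraMap r =>
    have : m = 0 := by
      by_contra h
      simp [Algebra.algebraMap_eq_smul_one, coeff_one, Ne.symm h] at hm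
    rw [this]
    exact isLow_zero
  | add x y _ _ hx hy =>
    rw [map_add, map_add, Finsupp.add_apply] at hm
    by_cases h : coeff (toTorus hp hγ x) m = 0
    · rw [h, zero_add] at hm
      exact hy hm
    · exact hx h
  | mul x y _ _ hx hy =>
    rw [map_mul] at hm
    obtain ⟨m', n', h1, h2, rfl⟩ := exists_of_coeff_mul_ne_zero hm
    exact (hx h1).add (hy h2)

/-! ### Injectivity of the homomorphism to the quantum torus -/

/-- `f` has leading exponent `L` for the degree in `zᵢ`, and is homogeneous in `vᵢ`. -/
def Lead (i : Fin t) (f : QTorus (torusMatrix p γ)) (L : Letter t → ℤ) : Prop :=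
  coeff f L ≠ 0 ∧ ∀ m, coeff f m ≠ 0 → m (.inr i) = L (.inr i) ∧ m (.inl i) ≤ L (.inl i) ∧
    (m (.inl i) = L (.inl i) → m = L)

/-- The degree in `.inl i` is additive and its top part is a single monomial on both sides, so the
top monomials multiply without cancellation. -/
theorem Lead.mul {i : Fin t} {f g : QTorus (torusMatrix p γ)} {L L' : Letter t → ℤ}
    (hf : Lead i f L) (hg : Lead i g L') : Lead i (f * g) (L + L') := by
  constructor
  · rw [coeff_mul_of_unique]
    · exact mul_ne_zero (mul_ne_zero (Units.ne_zero _) hf.1) hg.1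
    · intro m n hm hn h
      have h1 := hf.2 m hm
      have h2 := hg.2 n hn
      have h3 := congrFun h (.inl i)
      simp only [Pi.add_apply] at h3
      exact h2.2.2 (by omega)
  · intro r hr
    obtain ⟨m, n, hm, hn, rfl⟩ := exists_of_coeff_mul_ne_zero hr
    have h1 := hf.2 m hm
    have h2 := hg.2 n hn
    simp only [Pi.add_apply]
    refine ⟨by omega, by omega, fun h => ?_⟩
    rw [h1.2.2 (by omega), h2.2.2 (by omega)]

theorem lead_one (i : Fin t) : Lead i (1 : QTorus (torusMatrix p γ)) 0 := by
  refine ⟨by simp [coeff_one], fun m hm => ?_⟩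
  have : m = 0 := by
    by_contra h
    simp [coeff_one, Ne.symm h] at hm
  simp [this]

theorem Lead.pow {i : Fin t} {f : QTorus (torusMatrix p γ)} {L : Letter t → ℤ}
    (hf : Lead i f L) (n : ℕ) : Lead i (f ^ n) (n • L) := by
  induction n with
  | zero => simpa using lead_one i
  | succ n ih =>
    rw [pow_succ, succ_nsmul]
    exact ih.mul hf

theorem lead_torusGen (hγ : ∀ i, (γ i : k) ≠ 1) (a : Letter t) :
    Lead (idx a) (torusGen p γ a) (ex a) := by
  refine ⟨coeff_torusGen_ex hγ a, fun m hm => ?_⟩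
  obtain rfl | ⟨i, rfl, rfl⟩ := coeff_torusGen_ne_zero hm
  · simp
  · simp [ex, idx, eps_inl, eps_inr, zeta]

/-- The map `(c_{ba}) ↦ ∑ c_{ba} vᵢᵇ uᵢᵃ`. -/
def ofCoeffs (p : Matrix (Fin t) (Fin t) kˣ) (γ : Fin t → kˣ) (i : Fin t) :
    (ℕ × ℕ →₀ low p γ i) →ₗ[k] QWeyl p γ :=
  Finsupp.lsum k fun e => (LinearMap.mulRight k
    (gen p γ (.inr i) ^ e.1 * gen p γ (.inl i) ^ e.2)) ∘ₗ (low p γ i).val.toLinearMap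

theorem ofCoeffs_single (i : Fin t) (e : ℕ × ℕ) (c : low p γ i) :
    ofCoeffs p γ i (Finsupp.single e c) =
      c * (gen p γ (.inr i) ^ e.1 * gen p γ (.inl i) ^ e.2) := by
  simp [ofCoeffs, mul_assoc]

theorem mul_mem_range_ofCoeffs {i : Fin t} {g : QWeyl p γ}
    (h : ∀ (b a : ℕ) (c : low p γ i), (c : QWeyl p γ) *
      (gen p γ (.inr i) ^ b * gen p γ (.inl i) ^ a) * g ∈ LinearMap.range (ofCoeffs p γ i))
    {w : QWeyl p γ} (hw : w ∈ LinearMap.range (ofCoeffs p γ i)) :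
    w * g ∈ LinearMap.range (ofCoeffs p γ i) := by
  obtain ⟨c, rfl⟩ := hw
  induction c using Finsupp.induction_linear with
  | zero => simp
  | add f f' hf hf' =>
    rw [map_add, add_mul]
    exact add_mem hf hf'
  | single e c =>
    rw [ofCoeffs_single]
    exact h e.1 e.2 c

theorem qcommute_pow_left {R : Type*} [Ring R] [Algebra k R] {f g : R} {c : k}
    (h : f * g = c • (g * f)) (n : ℕ) : f ^ n * g = c ^ n • (g * f ^ n) := by
  induction n with
  | zero => simp
  | succ n ih =>
    rw [pow_succ, mul_assoc, h, mul_smul_comm, ← mul_assoc, ih, smul_mul_assoc, smul_smul,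
      mul_assoc, pow_succ, mul_comm c]

/-- The range contains `1`, so it suffices that it is stable under right multiplication by the
letters of index at most `i`. Lower letters q-commute past `vᵢᵇ uᵢᵃ` into the coefficient, and `uᵢ`
raises `a`. Only `vᵢ` needs an argument. -/
theorem mem_range_ofCoeffs (hp : IsMulAntisymm p) (i : Fin t) {y : QWeyl p γ}
    (hy : y ∈ low p γ (i + 1)) : y ∈ LinearMap.range (ofCoeffs p γ i) := by
  set S := LinearMap.range (ofCoeffs p γ i) with hS
  have hmem : ∀ (b a : ℕ) (c : QWeyl p γ), c ∈ low p γ i →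
      c * (gen p γ (.inr i) ^ b * gen p γ (.inl i) ^ a) ∈ S := fun b a c hc =>
    ⟨Finsupp.single (b, a) ⟨c, hc⟩, ofCoeffs_single _ _ _⟩
  have hu : ∀ w ∈ S, w * gen p γ (.inl i) ∈ S := fun w hw =>
    mul_mem_range_ofCoeffs (fun b a c => by
      rw [mul_assoc, mul_assoc, ← pow_succ]
      exact hmem b (a + 1) c c.2) hw
  have hv : ∀ w ∈ S, w * gen p γ (.inr i) ∈ S := fun w hw =>
    mul_mem_range_ofCoeffs (fun b a c => by
      induction a generalizing c with
      | zero =>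
        have := hmem (b + 1) 0 c c.2
        rw [pow_zero, mul_one] at this ⊢
        rwa [mul_assoc, ← pow_succ]
      | succ a ih =>
        -- Exchanging `uᵢ vᵢ` creates a summand `zᵢ`, which commutes with `vᵢᵇ uᵢᵃ` and can join the
        -- coefficient; the other summand has a smaller power of `uᵢ` before `vᵢ`.
        have hz : Commute (z p γ i) (gen p γ (.inr i) ^ b * gen p γ (.inl i) ^ a) :=
          ((commute_z_gen hp i (.inr i) le_rfl).pow_right b).mul_right
            ((commute_z_gen hp i (.inl i) le_rfl).pow_right a)
        have e : (c : QWeyl p γ) * (gen p γ (.inr i) ^ b * gen p γ (.inl i) ^ (a + 1)) *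
            gen p γ (.inr i) = (c * z p γ i) * (gen p γ (.inr i) ^ b * gen p γ (.inl i) ^ a) +
            (γ i : k) • ((c * (gen p γ (.inr i) ^ b * gen p γ (.inl i) ^ a) * gen p γ (.inr i)) *
              gen p γ (.inl i)) := by
          rw [mul_assoc (c : QWeyl p γ) (z p γ i), hz.eq, pow_succ]
          simp only [mul_assoc]
          rw [gen_inl_mul_inr_self]
          simp only [mul_add, mul_smul_comm]
        rw [e]
        exact add_mem (hmem b a _ (mul_mem c.2 (z_mem_low _))) (S.smul_mem _ (hu _ (ih c)))) hw
  have hlow : ∀ a : Letter t, (idx a : ℕ) < i → ∀ w ∈ S, w * gen p γ a ∈ S := fun a ha w hw =>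
    mul_mem_range_ofCoeffs (fun b a' c => by
      have hne : i ≠ idx a := fun e => by simp [← e] at ha
      have e : (c : QWeyl p γ) * (gen p γ (.inr i) ^ b * gen p γ (.inl i) ^ a') * gen p γ a =
          ((lcomm p γ (.inr i) a : k) ^ b * (lcomm p γ (.inl i) a : k) ^ a') •
          ((c * gen p γ a) * (gen p γ (.inr i) ^ b * gen p γ (.inl i) ^ a')) := by
        rw [mul_assoc, mul_assoc (gen p γ (.inr i) ^ b),
          qcommute_pow_left (gen_mul_gen hp (.inl i) a hne), mul_smul_comm, ← mul_assoc (_ ^ b),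
          qcommute_pow_left (gen_mul_gen hp (.inr i) a hne), smul_mul_assoc, smul_smul,
          mul_smul_comm, mul_comm ((lcomm p γ (.inl i) a : k) ^ a')]
        simp only [mul_assoc]
      rw [e]
      exact S.smul_mem _ (hmem b a' _ (mul_mem c.2 (gen_mem_low ha)))) hw
  have key : ∀ w ∈ S, w * y ∈ S := by
    induction hy using Algebra.adjoin_induction with
    | mem x hx =>
      obtain ⟨a, ha, rfl⟩ := hx
      rcases Nat.lt_succ_iff_lt_or_eq.1 ha with h | h
      · exact hlow a h
      · cases a with
        | inl j =>
          obtain rfl : j = i := Fin.ext h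
          exact hu
        | inr j =>
          obtain rfl : j = i := Fin.ext h
          exact hv
    | algebraMap r =>
      intro w hw
      rw [← Algebra.commutes, ← Algebra.smul_def]
      exact S.smul_mem _ hw
    | add x y _ _ hx hy =>
      intro w hw
      rw [mul_add]
      exact add_mem (hx w hw) (hy w hw)
    | mul x y _ _ hx hy =>
      intro w hw
      rw [← mul_assoc]
      exact hy _ (hx w hw)
  have h1 := key 1 (by simpa using hmem 0 0 1 (one_mem _))
  rwa [one_mul] at h1

/-- Induction on `n`, writing an element as `∑ c vᵢᵇ uᵢᵃ`. The top monomial of `vᵢᵇ uᵢᵃ` has degree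
`a` in `.inl i` and `b - a` in `.inr i`, while the coefficients involve neither letter. A term with
`a` maximal therefore contributes an exponent that no other term reaches. -/
theorem eq_zero_of_toTorus (hp : IsMulAntisymm p) (hγ : ∀ i, (γ i : k) ≠ 1) (n : ℕ) (hn : n ≤ t)
    {y : QWeyl p γ} (hy : y ∈ low p γ n) (h : toTorus hp hγ y = 0) : y = 0 := by
  induction n generalizing y with
  | zero =>
    have : low p γ 0 = ⊥ := by
      refine eq_bot_iff.2 (Algebra.adjoin_le ?_)
      rintro _ ⟨a, ha, -⟩
      exact absurd ha (Nat.not_lt_zero _)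
    rw [this, Algebra.mem_bot] at hy
    obtain ⟨r, rfl⟩ := hy
    rw [AlgHom.commutes] at h
    rw [(map_eq_zero_iff _ (algebraMap k (QTorus (torusMatrix p γ))).injective).1 h, map_zero]
  | succ n ih =>
    set i : Fin t := ⟨n, hn⟩
    obtain ⟨c, rfl⟩ := mem_range_ofCoeffs hp i hy
    by_contra hne
    have hc : c ≠ 0 := by
      rintro rfl
      simp at hne
    obtain ⟨e, he, hmax⟩ := Finset.exists_max_image c.support (fun e => e.2)
      (Finsupp.support_nonempty_iff.2 hc)
    have hce : toTorus hp hγ (c e) ≠ 0 := fun h0 =>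
      (Finsupp.mem_support_iff.1 he) (Subtype.ext (ih (by omega) (c e).2 h0))
    obtain ⟨m, hm⟩ := exists_coeff_ne_zero hce
    have lead : ∀ e : ℕ × ℕ, Lead i (torusGen p γ (.inr i) ^ e.1 * torusGen p γ (.inl i) ^ e.2)
        (e.1 • ex (.inr i) + e.2 • ex (.inl i)) := fun e =>
      ((lead_torusGen hγ (.inr i)).pow _).mul ((lead_torusGen hγ (.inl i)).pow _)
    have lu : ∀ e : ℕ × ℕ, (e.1 • ex (.inr i) + e.2 • ex (.inl i)) (.inl i) = (e.2 : ℤ) := by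
      intro e
      simp [ex, eps_inl, zeta]
    have lv : ∀ e : ℕ × ℕ, (e.1 • ex (.inr i) + e.2 • ex (.inl i)) (.inr i) = (e.1 - e.2 : ℤ) := by
      intro e
      simp [ex, eps_inr, zeta]
      ring
    have hlow : ∀ e m, coeff (toTorus hp hγ (c e)) m ≠ 0 → IsLow i m := fun e m hm =>
      isLow_of_mem_low hp hγ (c e).2 hm
    have hsum : toTorus hp hγ (ofCoeffs p γ i c) = ∑ e ∈ c.support, toTorus hp hγ (c e) *
        (torusGen p γ (.inr i) ^ e.1 * torusGen p γ (.inl i) ^ e.2) := by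
      conv_lhs => rw [← Finsupp.sum_single c]
      rw [Finsupp.sum, map_sum, map_sum]
      refine Finset.sum_congr rfl fun e _ => ?_
      rw [ofCoeffs_single, map_mul, map_mul, map_pow, map_pow, toTorus_gen, toTorus_gen]
    have hcoeff := DFunLike.congr_fun (congrArg coeff (hsum.symm.trans h))
      (m + (e.1 • ex (.inr i) + e.2 • ex (.inl i)))
    rw [map_sum, Finsupp.finsetSum_apply, Finset.sum_eq_single e] at hcoeff
    · rw [coeff_mul_of_unique] at hcoeff
      · rw [map_zero, Finsupp.zero_apply] at hcoeff
        exact mul_ne_zero (mul_ne_zero (Units.ne_zero _) hm) (lead e).1 hcoeff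
      · intro m' n' hm' hn' h'
        have h1 := congrFun h' (.inl i)
        simp only [Pi.add_apply, hlow e m' hm' (.inl i) le_rfl, hlow e m hm (.inl i) le_rfl,
          zero_add] at h1
        exact ((lead e).2 n' hn').2.2 h1
    · intro e' he' hne'
      by_contra h0
      obtain ⟨m', n', hm', hn', h'⟩ := exists_of_coeff_mul_ne_zero h0
      have h1 := congrFun h' (.inl i)
      have h2 := congrFun h' (.inr i)
      have h3 := (lead e').2 n' hn'
      rw [Pi.add_apply, Pi.add_apply m, hlow e' m' hm' _ le_rfl, hlow e m hm _ le_rfl, lu] at h1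
      rw [Pi.add_apply, Pi.add_apply m, hlow e' m' hm' _ le_rfl, hlow e m hm _ le_rfl, lv] at h2
      rw [lu, lv] at h3
      have h4 := hmax e' he'
      have h5 : e'.2 = e.2 := by omega
      exact hne' (Prod.ext (by omega) h5)
    · intro h0
      exact absurd he h0

theorem toTorus_injective (hp : IsMulAntisymm p) (hγ : ∀ i, (γ i : k) ≠ 1) :
    Function.Injective (toTorus hp hγ) :=
  (injective_iff_map_eq_zero _).2 fun _ h =>
    eq_zero_of_toTorus hp hγ t le_rfl (by rw [low_top]; trivial) h

/-! ### Exponents of elements of filtration degree `j + 1` -/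

theorem ex_inl_apply_inl (j : Fin t) : ex (.inl j) (.inl j) = 1 := by
  simp [ex, zeta, eps_inl]

theorem ex_inl_apply_inr (j : Fin t) : ex (.inl j) (.inr j) = -1 := by
  simp [ex, zeta, eps_inr]

theorem ex_inr_apply_inl (j : Fin t) : ex (.inr j) (.inl j) = 0 := eps_inl j j

theorem ex_inr_apply_inr (j : Fin t) : ex (.inr j) (.inr j) = 1 := by
  simp [ex, eps_inr]

theorem low_apply_inl (j : Fin t) : (zeta t j - eps j) (.inl j) = 0 := by
  simp [zeta, eps_inl]

theorem low_apply_inr (j : Fin t) : (zeta t j - eps j) (.inr j) = -1 := by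
  simp [zeta, eps_inr]

theorem not_isLow_ex (j : Fin t) (a : Letter t) (h : idx a = j) : ¬ IsLow j (ex a) := by
  subst h
  intro h
  cases a with
  | inl j =>
    have := h (.inl j) le_rfl
    simp [ex_inl_apply_inl] at this
  | inr j =>
    have := h (.inr j) le_rfl
    simp [ex_inr_apply_inr] at this

section Shape

variable (hp : IsMulAntisymm p) (hγ : ∀ i, (γ i : k) ≠ 1) {j : Fin t} {α β : k}
  {c : QWeyl p γ} (hc : c ∈ low p γ j)

/-- The exponents that occur in `α uⱼ + β vⱼ + c` with `c` in the lower subalgebra. -/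
theorem coeff_shape {m : Letter t → ℤ} (hc : c ∈ low p γ j)
    (hm : coeff (toTorus hp hγ (α • gen p γ (.inl j) + β • gen p γ (.inr j) + c)) m ≠ 0) :
    (α ≠ 0 ∧ (m = ex (.inl j) ∨ m = zeta t j - eps j)) ∨ (β ≠ 0 ∧ m = ex (.inr j)) ∨
      IsLow j m := by
  by_contra! h
  apply hm
  have h1 : α * coeff (torusGen p γ (.inl j)) m = 0 := by
    by_contra h0
    obtain ⟨h01, h02⟩ := mul_ne_zero_iff.1 h0
    obtain rfl | ⟨i, hi, rfl⟩ := coeff_torusGen_ne_zero h02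
    · exact (h.1 h01).1 rfl
    · obtain rfl : j = i := Sum.inl.inj hi
      exact (h.1 h01).2 rfl
  have h2 : β * coeff (torusGen p γ (.inr j)) m = 0 := by
    by_contra h0
    obtain ⟨h01, h02⟩ := mul_ne_zero_iff.1 h0
    obtain rfl | ⟨i, hi, rfl⟩ := coeff_torusGen_ne_zero h02
    · exact h.2.1 h01 rfl
    · cases hi
  have h3 : coeff (toTorus hp hγ c) m = 0 := by
    by_contra h0
    exact h.2.2 (isLow_of_mem_low hp hγ hc h0)
  simp only [map_add, map_smul, toTorus_gen, Finsupp.add_apply, Finsupp.smul_apply, smul_eq_mul,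
    h1, h2, h3, add_zero]

theorem coeff_shape_inl (hc : c ∈ low p γ j) :
    coeff (toTorus hp hγ (α • gen p γ (.inl j) + β • gen p γ (.inr j) + c)) (ex (.inl j)) =
      α * coeff (torusGen p γ (.inl j)) (ex (.inl j)) := by
  have h2 : coeff (torusGen p γ (.inr j)) (ex (.inl j)) = 0 := by
    by_contra h0
    obtain h | ⟨i, hi, -⟩ := coeff_torusGen_ne_zero h0
    · have := congrFun h (.inl j)
      simp [ex_inl_apply_inl, ex_inr_apply_inl] at this
    · cases hi
  have h3 : coeff (toTorus hp hγ c) (ex (.inl j)) = 0 := by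
    by_contra h0
    exact not_isLow_ex j (.inl j) rfl (isLow_of_mem_low hp hγ hc h0)
  simp only [map_add, map_smul, toTorus_gen, Finsupp.add_apply, Finsupp.smul_apply, smul_eq_mul,
    h2, h3, add_zero, mul_zero]

theorem coeff_shape_inr (hc : c ∈ low p γ j) :
    coeff (toTorus hp hγ (α • gen p γ (.inl j) + β • gen p γ (.inr j) + c)) (ex (.inr j)) = β := by
  have h2 : coeff (torusGen p γ (.inl j)) (ex (.inr j)) = 0 := by
    by_contra h0
    obtain h | ⟨i, hi, h⟩ := coeff_torusGen_ne_zero h0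
    · have := congrFun h (.inl j)
      simp [ex_inl_apply_inl, ex_inr_apply_inl] at this
    · obtain rfl : j = i := Sum.inl.inj hi
      have := congrFun h (.inr j)
      simp [low_apply_inr, ex_inr_apply_inr, -Pi.sub_apply] at this
  have h3 : coeff (toTorus hp hγ c) (ex (.inr j)) = 0 := by
    by_contra h0
    exact not_isLow_ex j (.inr j) rfl (isLow_of_mem_low hp hγ hc h0)
  have h4 : coeff (torusGen p γ (.inr j)) (ex (.inr j)) = 1 := by
    simp [torusGen, coeff_mono, ex]
  simp only [map_add, map_smul, toTorus_gen, Finsupp.add_apply, Finsupp.smul_apply, smul_eq_mul,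
    h2, h3, h4, add_zero, mul_zero, mul_one, zero_add]

theorem coeff_shape_low {m : Letter t → ℤ} (hm : IsLow j m) :
    coeff (toTorus hp hγ (α • gen p γ (.inl j) + β • gen p γ (.inr j) + c)) m =
      coeff (toTorus hp hγ c) m := by
  have h : ∀ a, idx a = j → coeff (torusGen p γ a) m = 0 := by
    rintro a rfl
    by_contra h0
    obtain rfl | ⟨i, rfl, rfl⟩ := coeff_torusGen_ne_zero h0
    · exact not_isLow_ex _ a rfl hm
    · have := hm (.inr i) le_rfl
      simp [low_apply_inr, -Pi.sub_apply] at this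
  simp only [map_add, map_smul, toTorus_gen, Finsupp.add_apply, Finsupp.smul_apply, smul_eq_mul,
    h (.inl j) rfl, h (.inr j) rfl, mul_zero, zero_add]

end Shape

/-! ### Commutation constraints on exponents -/

/-- The exponent `m` commutes with the exponents of index at most that of `a`, other than that of
`a` itself, as the exponent of `a` does, up to the character `W`. -/
structure Agree (p : Matrix (Fin t) (Fin t) kˣ) (γ : Fin t → kˣ) (a : Letter t)
    (W : AddChar (Letter t → ℤ) kˣ) (m : Letter t → ℤ) : Prop where
  comm_eps : ∀ i < idx a, comm (torusMatrix p γ) m (eps i) =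
    comm (torusMatrix p γ) (ex a) (eps i) * W (eps i)
  comm_zeta : ∀ n ≤ (idx a : ℕ), comm (torusMatrix p γ) m (zeta t n) = W (zeta t n)
  comm_swap : comm (torusMatrix p γ) m (ex a.swap) = lcomm p γ a a.swap * W (ex a.swap)

theorem comm_ex_zeta (n : ℕ) (b : Letter t) (h : n ≤ idx b) :
    comm (torusMatrix p γ) (ex b) (zeta t n) = 1 := by
  rw [comm_swap, comm_zeta_ex n b h, inv_one]

theorem ex_add_swap (a : Letter t) : ex a + ex a.swap = zeta t (idx a + 1) := by
  cases a with
  | inl i => exact ex_inl_add_inr i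
  | inr i => exact (add_comm _ _).trans (ex_inl_add_inr i)

/-- On exponents of lower index both sides are characters, so the comparison reduces to the letters
`z_n` and `v_i`. -/
theorem Agree.comm_eq_char {a : Letter t} {W : AddChar (Letter t → ℤ) kˣ} {m m' : Letter t → ℤ}
    (h : Agree p γ a W m) (hm' : m' = ex a.swap ∨ IsLow (idx a) m') :
    comm (torusMatrix p γ) (m - ex a) m' = W m' := by
  obtain rfl | hm' := hm'
  · rw [comm_sub_left, h.comm_swap, mul_right_comm, mul_inv_cancel, one_mul]
  · refine addChar_eq_of_single (commChar (torusMatrix p γ) (m - ex a)) W m' fun b hb => ?_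
    have hlt : idx b < idx a := by
      by_contra hn
      exact hb (hm' b (not_lt.1 hn))
    rw [commChar_apply, comm_sub_left]
    cases b with
    | inl i =>
      rw [← zeta_succ, h.comm_zeta (i + 1) hlt, comm_ex_zeta (i + 1) a hlt, inv_one, mul_one]
    | inr i =>
      change comm _ m (eps i) * (comm _ (ex a) (eps i))⁻¹ = W (eps i)
      rw [h.comm_eps i hlt, mul_right_comm, mul_inv_cancel, one_mul]

/-- `Agree` says nothing about the pairing with `ex a` itself. Since `ex a + ex a.swap` is the
exponent of `z_{idx a + 1}`, adding the latter to `m' - ex a` gives `m' + ex a.swap`, where the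
pairing is known. -/
theorem Agree.comm_sub_mul {a : Letter t} {W : AddChar (Letter t → ℤ) kˣ} {m m' : Letter t → ℤ}
    (h : Agree p γ a W m) (hm' : m' = ex a.swap ∨ IsLow (idx a) m') :
    comm (torusMatrix p γ) (m - ex a) (m' - ex a) *
      comm (torusMatrix p γ) (m - ex a) (zeta t (idx a + 1)) =
      W (m' - ex a) * W (zeta t (idx a + 1)) := by
  have e : m' - ex a + zeta t (idx a + 1) = m' + ex a.swap := by
    rw [← ex_add_swap]
    abel
  rw [← comm_add_right, ← AddChar.map_add_eq_mul, e, comm_add_right, AddChar.map_add_eq_mul,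
    h.comm_eq_char hm', h.comm_eq_char (.inl rfl)]

/-- Once `r` exceeds the index of `v_i`, the scalar of `z_r` with `v_i` is `γ_i`, independently of
`r`. -/
theorem comm_zeta_of_isLow {n r s : ℕ} {m : Letter t → ℤ} (hm : IsLow n m) (hr : n ≤ r)
    (hs : n ≤ s) (hrt : r ≤ t) (hst : s ≤ t) :
    comm (torusMatrix p γ) m (zeta t r) = comm (torusMatrix p γ) m (zeta t s) := by
  rw [comm_swap, comm_swap _ m]
  congr 1
  refine addChar_eq_of_single (commChar (torusMatrix p γ) _) (commChar (torusMatrix p γ) _) m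
    fun b hb => ?_
  have hlt : (idx b : ℕ) < n := by
    by_contra hn
    exact hb (hm b (not_lt.1 hn))
  rw [commChar_apply, commChar_apply]
  cases b with
  | inl i => rw [← zeta_succ, comm_zeta_zeta _ _ hrt i.2, comm_zeta_zeta _ _ hst i.2]
  | inr i =>
    change comm _ _ (eps i) = comm _ _ (eps i)
    change (i : ℕ) < n at hlt
    rw [comm_zeta_eps _ hrt, comm_zeta_eps _ hst, if_pos (lt_of_lt_of_le hlt hr),
      if_pos (lt_of_lt_of_le hlt hs)]

theorem comm_ex_zeta_succ_ne_one (hγ : ∀ i, (γ i : k) ≠ 1) (a : Letter t) :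
    comm (torusMatrix p γ) (ex a) (zeta t (idx a + 1)) ≠ 1 := by
  have h : ∀ i, γ i ≠ 1 := fun i hi => hγ i (by rw [hi, Units.val_one])
  cases a with
  | inl i =>
    simp [ex, idx, comm_sub_left, comm_zeta_zeta _ _ i.2 i.2, comm_eps_zeta _ i.2, h]
  | inr i => simp [ex, idx, comm_eps_zeta _ i.2, h]

/-- Take `m' = m` in `comm_sub_mul`: as `comm d d = 1` for `d = m - ex a`, the pairing of `d` with
`z_{idx a + 1}` is `1`. For `m` of lower index `z_{idx a + 1}` may be replaced by `z_{idx a}`, with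
which `m` pairs trivially. So `ex a` pairs trivially with `z_{idx a + 1}`, but that scalar is
`γ^{±1} ≠ 1`. -/
theorem Agree.not_isLow (hγ : ∀ i, (γ i : k) ≠ 1) {a : Letter t} {m : Letter t → ℤ}
    (h : Agree p γ a 1 m) : ¬ IsLow (idx a) m := by
  intro hm
  have h1 := h.comm_sub_mul (.inr hm)
  rw [comm_self, one_mul, AddChar.one_apply, AddChar.one_apply, one_mul, comm_sub_left,
    comm_zeta_of_isLow hm (Nat.le_succ _) le_rfl (idx a).2 (idx a).2.le, h.comm_zeta _ le_rfl,
    AddChar.one_apply, one_mul, inv_eq_one] at h1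
  exact comm_ex_zeta_succ_ne_one hγ a h1

/-! ### Automorphisms that respect the filtration -/

/-- `σ` scales `uᵢ` and `vᵢ` by mutually inverse scalars. -/
def IsDiagAt (σ : QWeyl p γ →ₐ[k] QWeyl p γ) (i : Fin t) : Prop :=
  ∃ α : kˣ, σ (gen p γ (.inl i)) = (α : k) • gen p γ (.inl i) ∧
    σ (gen p γ (.inr i)) = ((α⁻¹ : kˣ) : k) • gen p γ (.inr i)

theorem map_z {σ : QWeyl p γ →ₐ[k] QWeyl p γ} {n : ℕ}
    (h : ∀ i : Fin t, (i : ℕ) < n → IsDiagAt σ i) : σ (z p γ n) = z p γ n := by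
  rw [z, map_add, map_one, map_sum]
  congr 1
  refine Finset.sum_congr rfl fun l hl => ?_
  obtain ⟨α, h1, h2⟩ := h l (by simpa using hl)
  rw [map_smul, map_mul, h1, h2, smul_mul_smul_comm, ← Units.val_mul, inv_mul_cancel,
    Units.val_one, one_smul]

theorem map_mem_low {σ : QWeyl p γ →ₐ[k] QWeyl p γ} {n : ℕ}
    (h : ∀ i : Fin t, (i : ℕ) < n → IsDiagAt σ i) {c : QWeyl p γ} (hc : c ∈ low p γ n) :
    σ c ∈ low p γ n := by
  have : low p γ n ≤ (low p γ n).comap σ := by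
    refine Algebra.adjoin_le ?_
    rintro _ ⟨a, ha, rfl⟩
    obtain ⟨α, h1, h2⟩ := h (idx a) ha
    change σ (gen p γ a) ∈ low p γ n
    cases a with
    | inl i =>
      exact h1 ▸ Subalgebra.smul_mem _ (gen_mem_low ha) _
    | inr i =>
      exact h2 ▸ Subalgebra.smul_mem _ (gen_mem_low ha) _
  exact this hc

theorem gen_notMem_low (hp : IsMulAntisymm p) (hγ : ∀ i, (γ i : k) ≠ 1) (a : Letter t) :
    gen p γ a ∉ low p γ (idx a) := by
  intro h
  refine not_isLow_ex _ a rfl (isLow_of_mem_low hp hγ h ?_)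
  rw [toTorus_gen]
  exact coeff_torusGen_ex hγ a

/-- The filtration gives `σ u_j = α u_j + β v_j + c` and `σ v_j = α' u_j + β' v_j + c'` with `c`,
`c'` in the lower subalgebra. The relation between `u_j` and `v_j`, whose term `z_j` is fixed by
`σ`, is compared coefficient by coefficient in the torus, each time at an exponent reached by a
single product of monomials. -/
theorem isDiagAt_of_lt (hp : IsMulAntisymm p) (hγ : ∀ i, (γ i : k) ≠ 1)
    (hγ2 : ∀ i, (γ i : k) ^ 2 ≠ 1) {σ τ : QWeyl p γ →ₐ[k] QWeyl p γ} (hτσ : ∀ a, τ (σ a) = a)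
    (hσF : ∀ n, ∀ a ∈ filtration p γ n, σ a ∈ filtration p γ n) (j : Fin t)
    (hσ : ∀ i < j, IsDiagAt σ i) (hτ : ∀ i < j, IsDiagAt τ i) : IsDiagAt σ j := by
  have hgenF : ∀ a : Letter t, idx a = j → gen p γ a ∈ filtration p γ (j + 1) := by
    rintro a rfl
    exact Submodule.subset_span ⟨[a], by simp [deg_eq], by simp⟩
  obtain ⟨α, β, c, hc, hu⟩ := exists_of_mem_filtration (hσF _ _ (hgenF (.inl j) rfl))
  obtain ⟨α', β', c', hc', hv⟩ := exists_of_mem_filtration (hσF _ _ (hgenF (.inr j) rfl))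
  -- Otherwise `τ` would carry `σ (gen a)`, and hence `gen a`, into the lower subalgebra.
  have hnotlow : ∀ a : Letter t, idx a = j → σ (gen p γ a) ∉ low p γ j := by
    rintro a rfl h
    refine gen_notMem_low hp hγ a ?_
    rw [← hτσ (gen p γ a)]
    exact map_mem_low hτ h
  set f := toTorus hp hγ (σ (gen p γ (.inl j))) with hf
  set f' := toTorus hp hγ (σ (gen p γ (.inr j))) with hf'
  set κ := coeff (torusGen p γ (.inl j)) (ex (.inl j)) with hκ
  have hκ0 : κ ≠ 0 := coeff_torusGen_ex hγ _
  have fu : coeff f (ex (.inl j)) = α * κ := by rw [hf, hu, coeff_shape_inl hp hγ hc]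
  have fv : coeff f (ex (.inr j)) = β := by rw [hf, hu, coeff_shape_inr hp hγ hc]
  have fu' : coeff f' (ex (.inl j)) = α' * κ := by rw [hf', hv, coeff_shape_inl hp hγ hc']
  have fv' : coeff f' (ex (.inr j)) = β' := by rw [hf', hv, coeff_shape_inr hp hγ hc']
  have fs : ∀ m, coeff f m ≠ 0 → (α ≠ 0 ∧ (m = ex (.inl j) ∨ m = zeta t j - eps j)) ∨
      (β ≠ 0 ∧ m = ex (.inr j)) ∨ IsLow j m := fun m hm => by
    rw [hf, hu] at hm
    exact coeff_shape hp hγ hc hm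
  have fs' : ∀ m, coeff f' m ≠ 0 → (α' ≠ 0 ∧ (m = ex (.inl j) ∨ m = zeta t j - eps j)) ∨
      (β' ≠ 0 ∧ m = ex (.inr j)) ∨ IsLow j m := fun m hm => by
    rw [hf', hv] at hm
    exact coeff_shape hp hγ hc' hm
  have hrel : f * f' = mono (torusMatrix p γ) (zeta t j) + (γ j : k) • (f' * f) := by
    rw [hf, hf', ← map_mul, ← map_mul σ, gen_inl_mul_inr_self, map_add, map_smul, map_mul σ,
      map_z hσ, map_add, map_smul, map_mul, toTorus_z hp hγ _ j.2.le]
  have hrelc : ∀ m, m ≠ zeta t j → coeff (f * f') m = (γ j : k) * coeff (f' * f) m := by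
    intro m hm
    rw [hrel, map_add, map_smul, coeff_mono, Finsupp.add_apply, Finsupp.single_apply,
      if_neg hm.symm, zero_add, Finsupp.smul_apply, smul_eq_mul]
  have inl_le : ∀ (x y : k) (m : Letter t → ℤ),
      ((x ≠ 0 ∧ (m = ex (.inl j) ∨ m = zeta t j - eps j)) ∨
        (y ≠ 0 ∧ m = ex (.inr j)) ∨ IsLow j m) →
      m (.inl j) ≤ 1 ∧ (m (.inl j) = 1 → x ≠ 0 ∧ m = ex (.inl j)) := by
    rintro x y m (⟨hx, rfl | rfl⟩ | ⟨-, rfl⟩ | h)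
    · simp [ex_inl_apply_inl, hx]
    · simp [low_apply_inl, -Pi.sub_apply]
    · simp [ex_inr_apply_inl]
    · simp [h (.inl j) le_rfl]
  have inr_le : ∀ (x y : k) (m : Letter t → ℤ),
      ((x ≠ 0 ∧ (m = ex (.inl j) ∨ m = zeta t j - eps j)) ∨
        (y ≠ 0 ∧ m = ex (.inr j)) ∨ IsLow j m) →
      m (.inr j) ≤ 1 ∧ (m (.inr j) = 1 → y ≠ 0 ∧ m = ex (.inr j)) := by
    rintro x y m (⟨-, rfl | rfl⟩ | ⟨hy, rfl⟩ | h)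
    · simp [ex_inl_apply_inr]
    · simp [low_apply_inr, -Pi.sub_apply]
    · simp [ex_inr_apply_inr, hy]
    · simp [h (.inr j) le_rfl]
  -- At the exponent of `u_j²` the relation reads `(1 - γ_j) α α' = 0`, up to nonzero factors; `hββ`
  -- is the same for `v_j²`.
  have hαα : α = 0 ∨ α' = 0 := by
    have h := hrelc (ex (.inl j) + ex (.inl j)) (fun h => by
      have := congrFun h (.inl j)
      simp [ex_inl_apply_inl, zeta] at this)
    rw [coeff_mul_of_unique, coeff_mul_of_unique, fu, fu'] at h
    · by_contra! h0
      have h1 : (cocycle (torusMatrix p γ) (ex (.inl j)) (ex (.inl j)) : k) * α * κ * α' * κ ≠ 0 :=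
        mul_ne_zero (mul_ne_zero (mul_ne_zero (mul_ne_zero (Units.ne_zero _) h0.1) hκ0) h0.2) hκ0
      refine hγ j (mul_right_cancel₀ h1 ?_)
      linear_combination -h
    · intro m n hm hn h
      have h1 := inl_le _ _ m (fs' m hm)
      have h2 := inl_le _ _ n (fs n hn)
      have h3 := congrFun h (.inl j)
      simp only [Pi.add_apply, ex_inl_apply_inl] at h3
      exact (h2.2 (by omega)).2
    · intro m n hm hn h
      have h1 := inl_le _ _ m (fs m hm)
      have h2 := inl_le _ _ n (fs' n hn)
      have h3 := congrFun h (.inl j)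
      simp only [Pi.add_apply, ex_inl_apply_inl] at h3
      exact (h2.2 (by omega)).2
  have hββ : β = 0 ∨ β' = 0 := by
    have h := hrelc (ex (.inr j) + ex (.inr j)) (fun h => by
      have := congrFun h (.inr j)
      simp [ex_inr_apply_inr, zeta] at this)
    rw [coeff_mul_of_unique, coeff_mul_of_unique, fv, fv'] at h
    · by_contra! h0
      have h1 : (cocycle (torusMatrix p γ) (ex (.inr j)) (ex (.inr j)) : k) * β * β' ≠ 0 :=
        mul_ne_zero (mul_ne_zero (Units.ne_zero _) h0.1) h0.2
      refine hγ j (mul_right_cancel₀ h1 ?_)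
      linear_combination -h
    · intro m n hm hn h
      have h1 := inr_le _ _ m (fs' m hm)
      have h2 := inr_le _ _ n (fs n hn)
      have h3 := congrFun h (.inr j)
      simp only [Pi.add_apply, ex_inr_apply_inr] at h3
      exact (h2.2 (by omega)).2
    · intro m n hm hn h
      have h1 := inr_le _ _ m (fs m hm)
      have h2 := inr_le _ _ n (fs' n hn)
      have h3 := congrFun h (.inr j)
      simp only [Pi.add_apply, ex_inr_apply_inr] at h3
      exact (h2.2 (by omega)).2
  have huv : lcomm p γ (.inl j) (.inr j) = γ j := by
    rw [lcomm_inl_inr hp, if_pos le_rfl, hp.1, mul_one]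
  have huv' : comm (torusMatrix p γ) (ex (.inl j)) (ex (.inr j)) = γ j := huv
  have h_ne : α ≠ 0 ∨ β ≠ 0 := by
    by_contra! h0
    refine hnotlow (.inl j) rfl ?_
    rw [hu, h0.1, h0.2]
    simpa using hc
  have h_ne' : α' ≠ 0 ∨ β' ≠ 0 := by
    by_contra! h0
    refine hnotlow (.inr j) rfl ?_
    rw [hv, h0.1, h0.2]
    simpa using hc'
  -- An interchange of `u_j` and `v_j` is excluded here: `σ u_j` would lead with `v_j` and `σ v_j`
  -- with `u_j`, and since the leading monomials satisfy `u v = γ_j v u`, the relation would give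
  -- `γ_j² = 1`.
  have hβ : β = 0 := by
    by_contra hβ
    have hβ' : β' = 0 := hββ.resolve_left hβ
    have hα' : α' ≠ 0 := h_ne'.resolve_right (not_not.2 hβ')
    have hα : α = 0 := hαα.resolve_right hα'
    have h := hrelc (ex (.inr j) + ex (.inl j)) (fun h => by
      have := congrFun h (.inl j)
      simp [ex_inl_apply_inl, ex_inr_apply_inl, zeta] at this)
    rw [coeff_mul_of_unique, add_comm (ex (.inr j)), coeff_mul_of_unique, fv, fu',
      cocycle_eq_comm_mul _ (ex (.inl j)), huv'] at h
    · have h1 : (cocycle (torusMatrix p γ) (ex (.inr j)) (ex (.inl j)) : k) * β * α' * κ ≠ 0 :=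
        mul_ne_zero (mul_ne_zero (mul_ne_zero (Units.ne_zero _) hβ) hα') hκ0
      refine hγ2 j (mul_right_cancel₀ h1 ?_)
      rw [Units.val_mul] at h
      linear_combination -h
    · intro m n hm hn h
      have h1 := inl_le _ _ m (fs' m hm)
      have h2 := inl_le _ _ n (fs n hn)
      have h3 := congrFun h (.inl j)
      simp only [Pi.add_apply, ex_inl_apply_inl, ex_inr_apply_inl] at h3
      have h4 : n (.inl j) ≠ 1 := fun e => (h2.2 e).1 hα
      rw [(h1.2 (by omega)).2] at h
      exact add_left_cancel h
    · intro m n hm hn h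
      have h1 := inl_le _ _ m (fs m hm)
      have h2 := inl_le _ _ n (fs' n hn)
      have h3 := congrFun h (.inl j)
      simp only [Pi.add_apply, ex_inl_apply_inl, ex_inr_apply_inl] at h3
      have h4 : m (.inl j) ≠ 1 := fun e => (h1.2 e).1 hα
      exact (h2.2 (by omega)).2
  have hα : α ≠ 0 := h_ne.resolve_right (not_not.2 hβ)
  have hα' : α' = 0 := hαα.resolve_left hα
  have hβ' : β' ≠ 0 := h_ne'.resolve_left (not_not.2 hα')
  have hinr : ∀ m, coeff f m ≠ 0 → m (.inr j) ≤ 0 := by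
    intro m hm
    obtain ⟨-, rfl | rfl⟩ | ⟨h, -⟩ | h := fs m hm
    · simp [ex_inl_apply_inr]
    · simp [low_apply_inr, -Pi.sub_apply]
    · exact absurd hβ h
    · simp [h (.inr j) le_rfl]
  have hinl' : ∀ m, coeff f' m ≠ 0 → m (.inl j) = 0 := by
    intro m hm
    obtain ⟨h, -⟩ | ⟨-, rfl⟩ | h := fs' m hm
    · exact absurd hα' h
    · simp [ex_inr_apply_inl]
    · simp [h (.inl j) le_rfl]
  have hqeps : ∀ (a : Letter t), idx a = j → ∀ m, coeff (toTorus hp hγ (σ (gen p γ a))) m ≠ 0 →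
      ∀ i < idx a, comm (torusMatrix p γ) m (eps i) = comm (torusMatrix p γ) (ex a) (eps i) := by
    rintro a rfl m hm i hi
    refine comm_eq_of_mul_mono ?_ hm
    obtain ⟨ξ, -, h2⟩ := hσ i hi
    have h := congrArg (fun y => toTorus hp hγ (σ y)) (gen_mul_gen hp a (.inr i) hi.ne')
    simp only [map_mul, map_smul, h2, mul_smul_comm, smul_mul_assoc] at h
    rw [smul_comm] at h
    have h' := (Units.isUnit ξ⁻¹).smul_left_cancel.1 h
    rw [toTorus_gen hp hγ (.inr i)] at h'
    exact h'
  have hqzeta : ∀ (a : Letter t), idx a = j → ∀ m, coeff (toTorus hp hγ (σ (gen p γ a))) m ≠ 0 →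
      ∀ n ≤ (idx a : ℕ), comm (torusMatrix p γ) m (zeta t n) = 1 := by
    rintro a rfl m hm n hn
    refine comm_eq_of_mul_mono ?_ hm
    have h := congrArg (fun y => toTorus hp hγ (σ y)) (commute_z_gen hp n a hn).eq
    simp only [map_mul, map_z (fun i hi => hσ i (Fin.lt_def.2 (lt_of_lt_of_le hi hn))),
      toTorus_z hp hγ n (hn.trans (idx a).2.le)] at h
    rw [Units.val_one, one_smul, h]
  -- An exponent of `c` commutes with the lower letters as `u_j` does, by the relations transported
  -- by `σ`. It also does so with `v_j`, by the coefficient at `m + ex (.inr j)`. This is `Agree`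
  -- with trivial character, which no exponent of lower index satisfies.
  have hc0 : c = 0 := by
    by_contra hne
    obtain ⟨m, hm⟩ := exists_coeff_ne_zero fun h => hne (toTorus_injective hp hγ
      (h.trans (map_zero _).symm))
    have hlow := isLow_of_mem_low hp hγ hc hm
    have hfm : coeff f m ≠ 0 := by rwa [hf, hu, coeff_shape_low hp hγ hlow]
    refine Agree.not_isLow (a := .inl j) (p := p) hγ (m := m) ⟨?_, ?_, ?_⟩ hlow
    · simpa using hqeps (.inl j) rfl m hfm
    · simpa using hqzeta (.inl j) rfl m hfm
    · have h := hrelc (m + ex (.inr j)) (fun h => by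
        have := congrFun h (.inr j)
        simp [ex_inr_apply_inr, zeta, hlow (.inr j) le_rfl] at this)
      rw [coeff_mul_of_unique, add_comm m, coeff_mul_of_unique, fv', cocycle_eq_comm_mul _ m] at h
      · have h1 : (cocycle (torusMatrix p γ) (ex (.inr j)) m : k) * β' * coeff f m ≠ 0 :=
          mul_ne_zero (mul_ne_zero (Units.ne_zero _) hβ') hfm
        rw [AddChar.one_apply, mul_one, Sum.swap_inl, huv]
        refine Units.ext (mul_right_cancel₀ h1 ?_)
        rw [Units.val_mul] at h
        linear_combination h
      · intro m' n' hm' hn' h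
        have h1 := inr_le _ _ m' (fs' m' hm')
        have h2 := hinr n' hn'
        have h3 := congrFun h (.inr j)
        simp only [Pi.add_apply, ex_inr_apply_inr, hlow (.inr j) le_rfl] at h3
        rw [(h1.2 (by omega)).2] at h
        exact add_left_cancel h
      · intro m' n' hm' hn' h
        have h1 := inr_le _ _ n' (fs' n' hn')
        have h2 := hinr m' hm'
        have h3 := congrFun h (.inr j)
        simp only [Pi.add_apply, ex_inr_apply_inr, hlow (.inr j) le_rfl] at h3
        exact (h1.2 (by omega)).2
  have hc0' : c' = 0 := by
    by_contra hne
    obtain ⟨m, hm⟩ := exists_coeff_ne_zero fun h => hne (toTorus_injective hp hγ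
      (h.trans (map_zero _).symm))
    have hlow := isLow_of_mem_low hp hγ hc' hm
    have hfm : coeff f' m ≠ 0 := by rwa [hf', hv, coeff_shape_low hp hγ hlow]
    refine Agree.not_isLow (a := .inr j) (p := p) hγ (m := m) ⟨?_, ?_, ?_⟩ hlow
    · simpa using hqeps (.inr j) rfl m hfm
    · simpa using hqzeta (.inr j) rfl m hfm
    · have h := hrelc (m + ex (.inl j)) (fun h => by
        have := congrFun h (.inl j)
        simp [ex_inl_apply_inl, zeta, hlow (.inl j) le_rfl] at this)
      rw [add_comm m, coeff_mul_of_unique f f', add_comm _ m, coeff_mul_of_unique f' f, fu,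
        cocycle_eq_comm_mul _ (ex (.inl j))] at h
      · have h1 : (cocycle (torusMatrix p γ) m (ex (.inl j)) : k) * (α * κ) * coeff f' m ≠ 0 :=
          mul_ne_zero (mul_ne_zero (Units.ne_zero _) (mul_ne_zero hα hκ0)) hfm
        rw [AddChar.one_apply, mul_one, Sum.swap_inr, lcomm, comm_swap, comm_swap _ (ex (.inr j)),
          huv', inv_inj]
        refine Units.ext (mul_right_cancel₀ h1 ?_)
        rw [Units.val_mul] at h
        linear_combination h
      · intro m' n' hm' hn' h
        have h1 := inl_le _ _ n' (fs n' hn')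
        have h2 := hinl' m' hm'
        have h3 := congrFun h (.inl j)
        simp only [Pi.add_apply, ex_inl_apply_inl, hlow (.inl j) le_rfl] at h3
        exact (h1.2 (by omega)).2
      · intro m' n' hm' hn' h
        have h1 := inl_le _ _ m' (fs m' hm')
        have h2 := hinl' n' hn'
        have h3 := congrFun h (.inl j)
        simp only [Pi.add_apply, ex_inl_apply_inl, hlow (.inl j) le_rfl] at h3
        rw [(h1.2 (by omega)).2] at h
        exact add_left_cancel h
  rw [hβ, hc0, zero_smul, add_zero, add_zero] at hu
  rw [hα', hc0', zero_smul, zero_add, add_zero] at hv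
  -- With both images diagonal, the transported relation becomes `α β' z_j = z_j`.
  have hαβ : α * β' = 1 := by
    have h := congrArg σ (gen_inl_mul_inr_self (p := p) (γ := γ) j)
    rw [map_mul, map_add, map_smul, map_mul, hu, hv, map_z hσ, smul_mul_smul_comm,
      smul_mul_smul_comm, gen_inl_mul_inr_self, smul_add, smul_comm (γ j : k), mul_comm β',
      add_left_inj] at h
    have h' := DFunLike.congr_fun (congrArg (fun y => coeff (toTorus hp hγ y)) h) (zeta t j)
    simpa [toTorus_z hp hγ _ j.2.le, coeff_mono] using h'
  refine ⟨Units.mk0 α hα, hu, ?_⟩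
  rw [hv, Units.val_inv_eq_inv_val, Units.val_mk0, eq_inv_of_mul_eq_one_right hαβ]

/-- The induction treats `σ` and its inverse together, because the step for one needs that the other
preserves the lower subalgebra. -/
theorem isDiagAt (hp : IsMulAntisymm p) (hγ : ∀ i, (γ i : k) ≠ 1)
    (hγ2 : ∀ i, (γ i : k) ^ 2 ≠ 1) {σ τ : QWeyl p γ →ₐ[k] QWeyl p γ} (hτσ : ∀ a, τ (σ a) = a)
    (hστ : ∀ a, σ (τ a) = a)
    (hσF : ∀ n, ∀ a ∈ filtration p γ n, σ a ∈ filtration p γ n)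
    (hτF : ∀ n, ∀ a ∈ filtration p γ n, τ a ∈ filtration p γ n) (j : Fin t) :
    IsDiagAt σ j := by
  suffices h : ∀ n, ∀ j : Fin t, (j : ℕ) < n → IsDiagAt σ j ∧ IsDiagAt τ j from
    (h (j + 1) j (Nat.lt_succ_self _)).1
  intro n
  induction n with
  | zero => intro j hj; exact absurd hj (Nat.not_lt_zero _)
  | succ n ih =>
    intro j hj
    have hσ : ∀ i < j, IsDiagAt σ i := fun i hi =>
      (ih i (lt_of_lt_of_le hi (Nat.lt_succ_iff.1 hj))).1
    have hτ : ∀ i < j, IsDiagAt τ i := fun i hi =>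
      (ih i (lt_of_lt_of_le hi (Nat.lt_succ_iff.1 hj))).2
    exact ⟨isDiagAt_of_lt hp hγ hγ2 hτσ hσF j hσ hτ, isDiagAt_of_lt hp hγ hγ2 hστ hτF j hτ hσ⟩

/-- The character with value `αᵢ⁻¹` at the exponent of `vᵢ` that is trivial at the exponents of
the normal elements. -/
def diagChar (α : Fin t → kˣ) : AddChar (Letter t → ℤ) kˣ where
  toFun n := ∏ i, α i ^ (-(n (.inr i)))
  map_zero_eq_one' := by simp
  map_add_eq_mul' m n := by
    simp only [Pi.add_apply, neg_add, zpow_add, Finset.prod_mul_distrib]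

theorem diagChar_eps (α : Fin t → kˣ) (i : Fin t) : diagChar α (eps i) = (α i)⁻¹ := by
  change ∏ l, α l ^ (-(eps i (.inr l))) = _
  rw [Finset.prod_eq_single i]
  · simp [eps_inr]
  · intro l _ hl
    simp [eps_inr, hl]
  · simp

theorem diagChar_zeta (α : Fin t → kˣ) (n : ℕ) : diagChar α (zeta t n) = 1 := by
  change ∏ l, α l ^ (-(zeta t n (.inr l))) = _
  simp [zeta_inr]

theorem exists_char {σ : QWeyl p γ →ₐ[k] QWeyl p γ} (h : ∀ i, IsDiagAt σ i) :
    ∃ W : AddChar (Letter t → ℤ) kˣ, (∀ n, W (zeta t n) = 1) ∧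
      ∀ a, σ (gen p γ a) = (W (ex a) : k) • gen p γ a := by
  choose α h1 h2 using h
  refine ⟨diagChar α, diagChar_zeta α, fun a => ?_⟩
  cases a with
  | inl i => rw [h1, ex, AddChar.map_sub_eq_div, diagChar_zeta, diagChar_eps, one_div, inv_inv]
  | inr i => rw [h2, ex, diagChar_eps]

/-- The two monomials of `u_i` differ by a quotient of `z`'s, on which `W` is trivial, so they have
the same weight; characters are compatible with products. -/
theorem coeff_map (hp : IsMulAntisymm p) (hγ : ∀ i, (γ i : k) ≠ 1)
    {σ : QWeyl p γ →ₐ[k] QWeyl p γ} {W : AddChar (Letter t → ℤ) kˣ}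
    (hW : ∀ n, W (zeta t n) = 1) (hσ : ∀ a, σ (gen p γ a) = (W (ex a) : k) • gen p γ a)
    (y : QWeyl p γ) (m : Letter t → ℤ) :
    coeff (toTorus hp hγ (σ y)) m = W m * coeff (toTorus hp hγ y) m := by
  induction y using induction generalizing m with
  | hs c =>
    rw [AlgHom.commutes, AlgHom.commutes, Algebra.algebraMap_eq_smul_one, map_smul, coeff_one]
    by_cases hm : m = 0
    · simp [hm]
    · simp [Ne.symm hm]
  | hg a =>
    rw [hσ, map_smul, map_smul, toTorus_gen, Finsupp.smul_apply, smul_eq_mul]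
    by_cases h0 : coeff (torusGen p γ a) m = 0
    · simp [h0]
    · obtain rfl | ⟨i, rfl, rfl⟩ := coeff_torusGen_ne_zero h0
      · rfl
      · rw [ex, AddChar.map_sub_eq_div, AddChar.map_sub_eq_div, hW, hW]
  | hmul a b ha hb =>
    rw [map_mul σ, map_mul (toTorus hp hγ), map_mul (toTorus hp hγ), coeff_mul,
      coeff_mul, Finsupp.sum, Finsupp.sum, Finset.mul_sum]
    have hs : (coeff (toTorus hp hγ (σ b))).support = (coeff (toTorus hp hγ b)).support := by
      ext n
      simp [hb]
    rw [hs]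
    refine Finset.sum_congr rfl fun n _ => ?_
    have e : W m = W (m - n) * W n := by rw [← AddChar.map_add_eq_mul, sub_add_cancel]
    rw [ha, hb, e, Units.val_mul]
    ring
  | hadd a b ha hb =>
    simp only [map_add, Finsupp.add_apply, ha, hb, mul_add]

theorem idx_swap (a : Letter t) : idx a.swap = idx a := by cases a <;> rfl

theorem eq_swap_of_idx_eq {a b : Letter t} (hne : b ≠ a) (h : idx b = idx a) : b = a.swap := by
  cases a <;> cases b <;> simp_all [idx]

theorem lcomm_self_inl_inr (hp : IsMulAntisymm p) (j : Fin t) :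
    lcomm p γ (.inl j) (.inr j) = γ j := by
  rw [lcomm_inl_inr hp, if_pos le_rfl, hp.1, mul_one]

/-- A uniform form of the relations: the correction is a multiple of `z_{idx a}`, which a skew
derivation kills once it kills all letters of index below that of `a`. -/
theorem exists_gen_mul_gen (hp : IsMulAntisymm p) {a b : Letter t} (hne : b ≠ a)
    (hab : idx a ≤ idx b) : ∃ s : k, gen p γ a * gen p γ b =
      (lcomm p γ a b : k) • (gen p γ b * gen p γ a) + s • z p γ (idx a) := by
  rcases hab.lt_or_eq with h | h
  · exact ⟨0, by rw [gen_mul_gen hp a b h.ne, zero_smul, add_zero]⟩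
  · obtain rfl := eq_swap_of_idx_eq hne h.symm
    cases a with
    | inl j =>
      refine ⟨1, ?_⟩
      rw [Sum.swap_inl, lcomm_self_inl_inr hp, gen_inl_mul_inr_self, one_smul, add_comm]
      rfl
    | inr j =>
      refine ⟨-((γ j)⁻¹ : kˣ), ?_⟩
      rw [Sum.swap_inr, lcomm, comm_swap, ← lcomm, lcomm_self_inl_inr hp, gen_inl_mul_inr_self,
        smul_add, smul_smul, ← Units.val_mul, inv_mul_cancel, Units.val_one, one_smul, neg_smul,
        idx]
      abel

theorem ex_apply_self (b : Letter t) : ex b b = 1 := by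
  cases b with
  | inl j => exact ex_inl_apply_inl j
  | inr j => exact ex_inr_apply_inr j

theorem ex_swap_apply_nonpos (b : Letter t) : ex b.swap b ≤ 0 := by
  cases b with
  | inl j => exact (ex_inr_apply_inl j).le
  | inr j => simp [ex_inl_apply_inr]

/-! ### Skew derivations that respect the filtration -/

section Skew

/-- `X` is a `(σ, 1)`-skew derivation that respects the filtration and `χ`-commutes with the
diagonal automorphism `σ`, whose weights are given by `W`. -/
structure IsSkew (σ : QWeyl p γ →ₐ[k] QWeyl p γ) (W : AddChar (Letter t → ℤ) kˣ) (χ : kˣ)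
    (X : QWeyl p γ →ₗ[k] QWeyl p γ) : Prop where
  char_zeta : ∀ n, W (zeta t n) = 1
  map_gen : ∀ a, σ (gen p γ a) = (W (ex a) : k) • gen p γ a
  one : X 1 = 0
  mul : ∀ a b, X (a * b) = σ a * X b + X a * b
  mem_filtration : ∀ n, ∀ a ∈ filtration p γ n, X a ∈ filtration p γ n
  map_apply : ∀ a, σ (X a) = (χ : k) • X (σ a)
  char_ne_one : χ ≠ 1

/-- Here `σ` need not be the automorphism that twists `X`, so the weight formula applies to every
element of `G` and recovers the whole character `χ_l`. -/
theorem char_eq_of_coeff_ne_zero (hp : IsMulAntisymm p) (hγ : ∀ i, (γ i : k) ≠ 1)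
    {σ : QWeyl p γ →ₐ[k] QWeyl p γ} {W : AddChar (Letter t → ℤ) kˣ} {χ : kˣ}
    {X : QWeyl p γ →ₗ[k] QWeyl p γ} (hW : ∀ n, W (zeta t n) = 1)
    (hσ : ∀ a, σ (gen p γ a) = (W (ex a) : k) • gen p γ a)
    (hX : ∀ a, σ (X a) = (χ : k) • X (σ a)) {b : Letter t} {m : Letter t → ℤ}
    (hm : coeff (toTorus hp hγ (X (gen p γ b))) m ≠ 0) : W m = χ * W (ex b) := by
  have h := coeff_map hp hγ hW hσ (X (gen p γ b)) m
  rw [hX, hσ, map_smul, map_smul, map_smul, map_smul, map_smul, Finsupp.smul_apply,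
    Finsupp.smul_apply, smul_eq_mul, smul_eq_mul, ← mul_assoc] at h
  exact Units.ext (by simpa using (mul_right_cancel₀ hm h).symm)

variable {σ : QWeyl p γ →ₐ[k] QWeyl p γ} {W : AddChar (Letter t → ℤ) kˣ} {χ : kˣ}
  {X : QWeyl p γ →ₗ[k] QWeyl p γ}

theorem IsSkew.eq_zero_of_mem_low (hX : IsSkew σ W χ X) {n : ℕ}
    (h : ∀ b, (idx b : ℕ) < n → X (gen p γ b) = 0) {c : QWeyl p γ} (hc : c ∈ low p γ n) :
    X c = 0 := by
  induction hc using Algebra.adjoin_induction with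
  | mem x hx =>
    obtain ⟨a, ha, rfl⟩ := hx
    exact h a ha
  | algebraMap r => rw [Algebra.algebraMap_eq_smul_one, map_smul, hX.one, smul_zero]
  | add x y _ _ hx hy => rw [map_add, hx, hy, add_zero]
  | mul x y _ _ hx hy => rw [hX.mul, hx, hy, mul_zero, zero_mul, add_zero]

/-- The filtration bounds the exponents, and `ex b` itself is excluded because its weight would
force `χ = 1`. The last alternative is the second monomial of `u_j`, which occurs only when the
leading one does. -/
theorem IsSkew.coeff_gen (hp : IsMulAntisymm p) (hγ : ∀ i, (γ i : k) ≠ 1) (hX : IsSkew σ W χ X)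
    {b : Letter t} {m : Letter t → ℤ} (hm : coeff (toTorus hp hγ (X (gen p γ b))) m ≠ 0) :
    m = ex b.swap ∨ IsLow (idx b) m ∨ ∃ j, b = .inr j ∧ m = zeta t j - eps j ∧
      coeff (toTorus hp hγ (X (gen p γ b))) (ex b.swap) ≠ 0 := by
  have hb : gen p γ b ∈ filtration p γ (idx b + 1) :=
    Submodule.subset_span ⟨[b], by simp [deg_eq], by simp⟩
  obtain ⟨α, β, c, hc, e⟩ := exists_of_mem_filtration (hX.mem_filtration _ _ hb)
  have hself : coeff (toTorus hp hγ (X (gen p γ b))) (ex b) = 0 := by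
    by_contra h
    have := char_eq_of_coeff_ne_zero hp hγ hX.char_zeta hX.map_gen hX.map_apply h
    exact hX.char_ne_one (by simpa using this)
  cases b with
  | inl j =>
    simp only [idx] at e hc
    have hα : α = 0 := by
      rw [e, coeff_shape_inl hp hγ hc] at hself
      exact (mul_eq_zero.1 hself).resolve_right (coeff_torusGen_ex hγ _)
    rw [e] at hm
    obtain ⟨h, -⟩ | ⟨-, h⟩ | h := coeff_shape hp hγ hc hm
    · exact absurd hα h
    · exact .inl h
    · exact .inr (.inl h)
  | inr j =>
    simp only [idx] at e hc
    have hβ : β = 0 := by rwa [e, coeff_shape_inr hp hγ hc] at hself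
    rw [e] at hm
    obtain ⟨hα, h | h⟩ | ⟨h, -⟩ | h := coeff_shape hp hγ hc hm
    · exact .inl h
    · refine .inr (.inr ⟨j, rfl, h, ?_⟩)
      rw [e, Sum.swap_inr, coeff_shape_inl hp hγ hc]
      exact mul_ne_zero hα (coeff_torusGen_ex hγ _)
    · exact absurd hβ h
    · exact .inr (.inl h)

theorem IsSkew.apply_nonpos (hp : IsMulAntisymm p) (hγ : ∀ i, (γ i : k) ≠ 1)
    (hX : IsSkew σ W χ X) {b : Letter t} {m : Letter t → ℤ}
    (hm : coeff (toTorus hp hγ (X (gen p γ b))) m ≠ 0) : m b ≤ 0 := by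
  obtain rfl | h | ⟨j, rfl, rfl, -⟩ := hX.coeff_gen hp hγ hm
  · exact ex_swap_apply_nonpos b
  · exact (h b le_rfl).le
  · simp [low_apply_inr, -Pi.sub_apply]

theorem IsSkew.isLow_succ (hp : IsMulAntisymm p) (hγ : ∀ i, (γ i : k) ≠ 1)
    (hX : IsSkew σ W χ X) {b : Letter t} {m : Letter t → ℤ}
    (hm : coeff (toTorus hp hγ (X (gen p γ b))) m ≠ 0) : IsLow (idx b + 1) m := by
  obtain rfl | h | ⟨j, rfl, rfl, -⟩ := hX.coeff_gen hp hγ hm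
  · exact isLow_ex (by rw [idx_swap]; exact Nat.lt_succ_self _)
  · exact h.mono (Nat.le_succ _)
  · exact (isLow_zeta (Nat.le_succ _)).sub (isLow_eps (Nat.lt_succ_self _))

theorem torusGen_apply_nonpos {a b : Letter t} (hne : b ≠ a) (hab : idx a ≤ idx b)
    {m : Letter t → ℤ} (hm : coeff (torusGen p γ a) m ≠ 0) : m b ≤ 0 := by
  rcases hab.lt_or_eq with h | h
  · have hlow : IsLow (idx b) m := by
      obtain rfl | ⟨i, rfl, rfl⟩ := coeff_torusGen_ne_zero hm
      · exact isLow_ex h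
      · exact (isLow_zeta (le_of_lt h)).sub (isLow_eps h)
    exact (hlow b le_rfl).le
  · obtain rfl := eq_swap_of_idx_eq hne h.symm
    obtain rfl | ⟨i, rfl, rfl⟩ := coeff_torusGen_ne_zero hm
    · simpa using ex_swap_apply_nonpos a.swap
    · simp [low_apply_inr, -Pi.sub_apply]

/-- Applying `X` to `a b = λ b a + s z_{idx a}` gives `σ(a) X(b) + X(a) b = λ (σ(b) X(a) + X(b) a)`.
At the exponent `m + ex b` only the terms with `X(a)` survive, leaving `comm m (ex b) = λ W(ex b)`.
For lower `b` the terms with `X(b)` vanish outright. -/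
theorem IsSkew.exists_agree (hp : IsMulAntisymm p) (hγ : ∀ i, (γ i : k) ≠ 1)
    (hX : IsSkew σ W χ X) {a : Letter t} (hlow : ∀ b, idx b < idx a → X (gen p γ b) = 0)
    (ha : X (gen p γ a) ≠ 0) :
    ∃ m, coeff (toTorus hp hγ (X (gen p γ a))) m ≠ 0 ∧ Agree p γ a W m ∧
      (m = ex a.swap ∨ IsLow (idx a) m) ∧
      ∀ b, idx a < idx b → comm (torusMatrix p γ) m (ex b) = lcomm p γ a b * W (ex b) := by
  set f := toTorus hp hγ (X (gen p γ a)) with hf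
  have hf0 : f ≠ 0 := fun h => ha (toTorus_injective hp hγ (h.trans (map_zero _).symm))
  -- Maximality in the top torus letter discards the second monomial of `u_j` in `X v_j` and makes
  -- the factorization of `m + ex b` unique.
  obtain ⟨m, hm, hmax⟩ := Finset.exists_max_image (coeff f).support
    (fun m => m (.inl (idx a))) (Finsupp.support_nonempty_iff.2
      (fun h => hf0 (coeff_injective (h.trans (map_zero _).symm))))
  replace hm := Finsupp.mem_support_iff.1 hm
  replace hmax : ∀ m', coeff f m' ≠ 0 → m' (.inl (idx a)) ≤ m (.inl (idx a)) := fun m' hm' =>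
    hmax m' (Finsupp.mem_support_iff.2 hm')
  have hadm : m = ex a.swap ∨ IsLow (idx a) m := by
    obtain h | h | ⟨j, rfl, h, h'⟩ := hX.coeff_gen hp hγ hm
    · exact .inl h
    · exact .inr h
    · have := hmax _ h'
      rw [h] at this
      simp [idx, ex_inl_apply_inl, low_apply_inl, -Pi.sub_apply] at this
  have hcomm : ∀ b, b ≠ a → idx a ≤ idx b →
      comm (torusMatrix p γ) m (ex b) = lcomm p γ a b * W (ex b) := by
    intro b hne hab
    have hmb : 0 ≤ m b := by
      obtain rfl | h := hadm
      · rcases hab.lt_or_eq with h | h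
        · exact (isLow_ex (a := a.swap) (by rwa [idx_swap]) b le_rfl).ge
        · rw [eq_swap_of_idx_eq hne h.symm, ex_apply_self]
          exact zero_le_one
      · exact (h b hab).ge
    -- Using the second monomial of some `u_l` in place of the leading one would lower the degree in
    -- `.inl l`, and `m'` cannot make up for it, by lowness or by maximality of `m`.
    have hB : ∀ m' n', coeff f m' ≠ 0 → coeff (torusGen p γ b) n' ≠ 0 →
        m' + n' = m + ex b → m' = m ∧ n' = ex b := by
      intro m' n' hm' hn' h
      have hn : n' = ex b := by
        obtain h1 | ⟨l, rfl, rfl⟩ := coeff_torusGen_ne_zero hn'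
        · exact h1
        · have h1 := congrFun h (.inl l)
          rw [Pi.add_apply, Pi.add_apply, low_apply_inl, ex_inl_apply_inl] at h1
          rcases hab.lt_or_eq with h2 | h2
          · have h3 := hX.isLow_succ hp hγ hm' (.inl l) h2
            omega
          · have h3 := hmax m' hm'
            rw [h2] at h3
            simp only [idx] at h3
            omega
      exact ⟨by rw [hn] at h; exact add_right_cancel h, hn⟩
    -- The exponent `m + ex b` is positive at the letter `b`, while all exponents of `a` and of
    -- `X(b)` are at most zero there.
    have hzero : ∀ m' n', coeff (torusGen p γ a) m' ≠ 0 →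
        coeff (toTorus hp hγ (X (gen p γ b))) n' ≠ 0 → m' + n' ≠ m + ex b := by
      intro m' n' hm' hn' h
      have h1 := torusGen_apply_nonpos hne hab hm'
      have h2 := hX.apply_nonpos hp hγ hn'
      have h3 := congrFun h b
      rw [Pi.add_apply, Pi.add_apply, ex_apply_self] at h3
      omega
    obtain ⟨s, hs⟩ := exists_gen_mul_gen (γ := γ) hp hne hab
    have h := congrArg (fun y => coeff (toTorus hp hγ (X y)) (m + ex b)) hs
    simp only [map_add X, map_smul X, hX.mul, hX.map_gen,
      hX.eq_zero_of_mem_low hlow (z_mem_low _)] at h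
    simp only [smul_zero, add_zero, map_add, map_smul, map_mul, toTorus_gen, smul_mul_assoc,
      Finsupp.add_apply, Finsupp.smul_apply, smul_eq_mul] at h
    have z1 : coeff (torusGen p γ a * toTorus hp hγ (X (gen p γ b))) (m + ex b) = 0 := by
      by_contra h0
      obtain ⟨m', n', h1, h2, h3⟩ := exists_of_coeff_mul_ne_zero h0
      exact hzero m' n' h1 h2 h3
    have z2 : coeff (toTorus hp hγ (X (gen p γ b)) * torusGen p γ a) (m + ex b) = 0 := by
      by_contra h0
      obtain ⟨m', n', h1, h2, h3⟩ := exists_of_coeff_mul_ne_zero h0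
      exact hzero n' m' h2 h1 (by rw [add_comm, h3])
    have z3 : coeff (f * torusGen p γ b) (m + ex b) =
        cocycle (torusMatrix p γ) m (ex b) * coeff f m * coeff (torusGen p γ b) (ex b) :=
      coeff_mul_of_unique _ _ _ _ fun m' n' h1 h2 h3 => (hB m' n' h1 h2 h3).2
    have z4 : coeff (torusGen p γ b * f) (m + ex b) =
        cocycle (torusMatrix p γ) (ex b) m * coeff (torusGen p γ b) (ex b) * coeff f m := by
      rw [add_comm]
      exact coeff_mul_of_unique _ _ _ _ fun m' n' h1 h2 h3 =>
        (hB n' m' h2 h1 (by rw [add_comm, h3, add_comm])).1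
    rw [z1, z2, z3, z4, cocycle_eq_comm_mul, Units.val_mul] at h
    have h1 : (cocycle (torusMatrix p γ) (ex b) m : k) * coeff f m *
        coeff (torusGen p γ b) (ex b) ≠ 0 :=
      mul_ne_zero (mul_ne_zero (Units.ne_zero _) hm) (coeff_torusGen_ex hγ b)
    refine Units.ext (mul_right_cancel₀ h1 ?_)
    rw [Units.val_mul]
    linear_combination h
  refine ⟨m, hm, ⟨fun i hi => ?_, fun n hn => ?_, ?_⟩, hadm, fun b hb => ?_⟩
  · refine comm_eq_of_mul_mono (f := f) ?_ hm
    have h := congrArg (fun y => toTorus hp hγ (X y)) (gen_mul_gen hp a (.inr i) hi.ne')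
    simp only [map_smul X, hX.mul, hX.map_gen, hlow (.inr i) hi, mul_zero, zero_mul, zero_add,
      add_zero, smul_mul_assoc] at h
    rw [smul_smul] at h
    simp only [map_smul, map_mul, toTorus_gen] at h
    rw [Units.val_mul]
    exact h
  · rw [hX.char_zeta]
    refine comm_eq_of_mul_mono (f := f) ?_ hm
    have hz : σ (z p γ n) = z p γ n := by
      have hd : ∀ i, IsDiagAt σ i := fun i => ⟨W (ex (.inl i)), hX.map_gen _, by
        rw [hX.map_gen, ← eq_inv_of_mul_eq_one_right (?_ : W (ex (.inl i)) * W (ex (.inr i)) = 1)]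
        rw [← AddChar.map_add_eq_mul, ex_inl_add_inr, hX.char_zeta]⟩
      exact map_z fun i _ => hd i
    have h := congrArg (fun y => toTorus hp hγ (X y)) (commute_z_gen hp n a hn).eq
    simp only [hX.mul, hz, hX.eq_zero_of_mem_low hlow (low_mono hn (z_mem_low n)), mul_zero,
      zero_mul, add_zero, zero_add, map_mul, toTorus_z hp hγ n (hn.trans (idx a).2.le)] at h
    rw [Units.val_one, one_smul, h]
  · refine hcomm _ (fun e => ?_) (by rw [idx_swap])
    cases a <;> simp at e
  · exact hcomm b (fun e => by simp [e] at hb) hb.le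

end Skew

/-! ### Consequences for the weight of `m - ex a`, and the location of `a` -/

theorem Agree.comm_zeta_eq {a : Letter t} {W : AddChar (Letter t → ℤ) kˣ} {m : Letter t → ℤ}
    (hW : ∀ n, W (zeta t n) = 1) (h : Agree p γ a W m) (hm : m = ex a.swap ∨ IsLow (idx a) m) :
    comm (torusMatrix p γ) (m - ex a) (zeta t (idx a + 1)) = W (m - ex a) := by
  have e := h.comm_sub_mul hm
  rwa [comm_self, one_mul, hW, mul_one] at e

/-- Only `m` has to agree with `W`; `m'` may come from another skew derivation with the same `a`.
This is what links two different `x_l`. -/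
theorem Agree.comm_sub_mul_char {a : Letter t} {W : AddChar (Letter t → ℤ) kˣ}
    {m m' : Letter t → ℤ} (hW : ∀ n, W (zeta t n) = 1) (h : Agree p γ a W m)
    (hm : m = ex a.swap ∨ IsLow (idx a) m) (hm' : m' = ex a.swap ∨ IsLow (idx a) m') :
    comm (torusMatrix p γ) (m - ex a) (m' - ex a) * W (m - ex a) = W (m' - ex a) := by
  have e := h.comm_sub_mul hm'
  rwa [h.comm_zeta_eq hW hm, hW, mul_one] at e

theorem isLow_sub_ex {a : Letter t} {m : Letter t → ℤ} (hm : m = ex a.swap ∨ IsLow (idx a) m) :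
    IsLow (idx a + 1) (m - ex a) := by
  refine IsLow.sub ?_ (isLow_ex (Nat.lt_succ_self _))
  obtain rfl | h := hm
  · exact isLow_ex (by rw [idx_swap]; exact Nat.lt_succ_self _)
  · exact h.mono (Nat.le_succ _)

/-- A nonzero skew derivation that respects the filtration does not kill both generators of top
degree. -/
theorem IsSkew.exists_source (hp : IsMulAntisymm p) (hγ : ∀ i, (γ i : k) ≠ 1)
    {σ : QWeyl p γ →ₐ[k] QWeyl p γ} {W : AddChar (Letter t → ℤ) kˣ} {χ : kˣ}
    {X : QWeyl p γ →ₗ[k] QWeyl p γ} (hX : IsSkew σ W χ X) (hX0 : X ≠ 0) :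
    ∃ a m, (idx a : ℕ) + 1 = t ∧ coeff (toTorus hp hγ (X (gen p γ a))) m ≠ 0 ∧
      Agree p γ a W m ∧ (m = ex a.swap ∨ IsLow (idx a) m) := by
  classical
  have hne : (Finset.univ.filter fun a => X (gen p γ a) ≠ 0).Nonempty := by
    by_contra h
    refine hX0 (LinearMap.ext fun c => ?_)
    refine hX.eq_zero_of_mem_low (n := t) (fun b _ => ?_) (low_top (p := p) (γ := γ) ▸ trivial)
    by_contra hb
    exact h ⟨b, by simpa using hb⟩
  obtain ⟨a, ha, hmin⟩ := Finset.exists_min_image _ idx hne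
  have hlow : ∀ b, idx b < idx a → X (gen p γ b) = 0 := by
    intro b hb
    by_contra h
    exact absurd (hmin b (by simpa using h)) (not_le.2 hb)
  obtain ⟨m, hm, hA, hadm, hup⟩ := hX.exists_agree hp hγ hlow (by simpa using ha)
  refine ⟨a, m, ?_, hm, hA, hadm⟩
  by_contra hne
  have hlt : (idx a : ℕ) + 1 < t := lt_of_le_of_ne (idx a).2 hne
  -- Both letters of the next index pair with `m - ex a` through `W`, and their exponents add up to
  -- that of `z_{idx a + 2}`, where `W` is trivial. Yet `m - ex a` does not distinguish `z_{idx a +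
  -- 2}` from `z_{idx a + 1}`, with which its pairing is `χ`.
  have h1 : comm (torusMatrix p γ) (m - ex a) (zeta t (idx a + 1 + 1)) = 1 := by
    have e : ∀ b : Letter t, idx b = ⟨idx a + 1, hlt⟩ →
        comm (torusMatrix p γ) (m - ex a) (ex b) = W (ex b) := by
      intro b hb
      rw [comm_sub_left, hup b (by rw [hb]; exact Nat.lt_succ_self _), lcomm, mul_right_comm,
        mul_inv_cancel, one_mul]
    have e2 := ex_inl_add_inr (t := t) ⟨idx a + 1, hlt⟩
    simp only at e2
    rw [← e2, comm_add_right, e _ rfl, e _ rfl, ← AddChar.map_add_eq_mul, e2, hX.char_zeta]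
  rw [comm_zeta_of_isLow (isLow_sub_ex hadm) (Nat.le_succ _) le_rfl hlt (idx a).2,
    hA.comm_zeta_eq hX.char_zeta hadm, AddChar.map_sub_eq_div,
    char_eq_of_coeff_ne_zero hp hγ hX.char_zeta hX.map_gen hX.map_apply hm,
    mul_div_cancel_right] at h1
  exact hX.char_ne_one h1

/-- At index `0` the only exponent of lower index is `0`, so in either case `m` pairs trivially with
`ex a.swap`, which determines `W`. -/
theorem Agree.char_eps (hp : IsMulAntisymm p) {a : Letter t} {W : AddChar (Letter t → ℤ) kˣ}
    {m : Letter t → ℤ} (hW : ∀ n, W (zeta t n) = 1) (h : Agree p γ a W m)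
    (hm : m = ex a.swap ∨ IsLow (idx a) m) (ha : (idx a : ℕ) = 0) :
    W (eps (idx a)) = (γ (idx a))⁻¹ := by
  have h1 : W (ex a.swap) = (lcomm p γ a a.swap)⁻¹ := by
    refine eq_inv_of_mul_eq_one_right ?_
    rw [← h.comm_swap]
    obtain rfl | hm := hm
    · exact comm_self _ _
    · obtain rfl : m = 0 := funext fun b => hm b (by rw [ha]; exact Nat.zero_le _)
      exact comm_zero_left _ _
  cases a with
  | inl i => rwa [Sum.swap_inl, lcomm_self_inl_inr hp] at h1
  | inr i =>
    rw [Sum.swap_inr, lcomm, ← QTorus.comm_swap, ← lcomm, lcomm_self_inl_inr hp, ex,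
      AddChar.map_sub_eq_div, hW, one_div] at h1
    exact inv_eq_iff_eq_inv.1 h1

/-- If distinct elements with the same image under `f` have mutually inverse values `c`, none of
which has order at most two, then the fibres of `f` have at most two elements. -/
theorem card_le_two_mul_of_fibres {ι S M : Type*} [Fintype ι] [Fintype S] [DecidableEq S]
    [Group M] (f : ι → S) (c : ι → M) (hc : ∀ i, c i ^ 2 ≠ 1)
    (h : ∀ i j, i ≠ j → f i = f j → c i * c j = 1) : Fintype.card ι ≤ 2 * Fintype.card S := by
  refine Finset.card_le_mul_card_image_of_maps_to (f := f) (fun _ _ => Finset.mem_univ _) 2 ?_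
  intro s _
  by_contra! hs
  obtain ⟨i, hi, j, hj, l, hl, hij, hil, hjl⟩ := Finset.two_lt_card.1 hs
  simp only [Finset.mem_filter, Finset.mem_univ, true_and] at hi hj hl
  -- Both are the inverse of `c i`; then `c j * c l = 1` becomes `c j ^ 2 = 1`.
  have e : c j = c l := mul_left_cancel
    ((h i j hij (hi.trans hj.symm)).trans (h i l hil (hi.trans hl.symm)).symm)
  apply hc j
  rw [sq]
  nth_rw 2 [e]
  exact h j l hjl (hj.trans hl.symm)

theorem pow_ne_one_of_three_le_orderOf {M : Type*} [Monoid M] {x : M} (h : 3 ≤ orderOf x) :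
    x ≠ 1 ∧ x ^ 2 ≠ 1 :=
  ⟨fun e => by simp [e] at h, pow_ne_one_of_lt_orderOf two_ne_zero (by omega)⟩

end QWeyl

end

/-! ### The bound on the rank -/

open QWeyl QTorus in
theorem mainTheorem12 {k : Type*} [Field k] [IsAlgClosed k] [CharZero k]
    {G : Type*} [CommGroup G] [Finite G] {θ : ℕ} (D : QLSDatum k G θ)
    {t : ℕ} (ht : 1 ≤ t) (p : Matrix (Fin t) (Fin t) kˣ) (hp : IsMulAntisymm p) (γ : Fin t → kˣ)
    (ρ : HopfAction k (Bosonization D) (QWeyl p γ))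
    (hρ : ρ.InnerFaithful)
    (hF : ρ.Respects (QWeyl.filtration p γ))
    (hB : ∀ i, 3 ≤ orderOf (D.χ i (D.g i)))
    (hgr : ∀ a b : QWeyl.Letter t, a ≠ b → 3 ≤ orderOf (QWeyl.grParam p γ a b)) :
    θ ≤ 2 * (2 * t - 1) := by
  have hγ3 : ∀ i, γ i ≠ 1 ∧ γ i ^ 2 ≠ 1 := fun i => by
    have := hgr (.inl i) (.inr i) (by simp)
    rw [grParam, if_neg (lt_irrefl i), hp.1, mul_one] at this
    exact pow_ne_one_of_three_le_orderOf this
  have hγ : ∀ i, (γ i : k) ≠ 1 := fun i h => (hγ3 i).1 (Units.ext h)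
  have hγ2 : ∀ i, (γ i : k) ^ 2 ≠ 1 := fun i h => (hγ3 i).2 (Units.ext (by simpa using h))
  have hinv : ∀ h a, ρ.grpHom h (ρ.grpHom h⁻¹ a) = a := fun h a => by
    simpa using ρ.grpHom_inv h⁻¹ a
  choose W hW hσ using fun h : G => exists_char fun i => isDiagAt hp hγ hγ2 (ρ.grpHom_inv h)
    (hinv h) (fun n a ha => hF n _ a ha) (fun n a ha => hF n _ a ha) i
  have hX : ∀ l, IsSkew (ρ.grpHom (D.g l)) (W (D.g l)) (D.χ l (D.g l))
      (ρ.act (Bosonization.x D l)) := fun l =>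
    { char_zeta := hW _
      map_gen := hσ _
      one := ρ.act_x_one l
      mul := ρ.act_x_mul l
      mem_filtration := fun n a ha => hF n _ a ha
      map_apply := ρ.grpHom_act_x _ l
      char_ne_one := (pow_ne_one_of_three_le_orderOf (hB l)).1 }
  choose a m ha hm hA hadm using fun l => (hX l).exists_source hp hγ (ρ.act_x_ne_zero hρ l)
  -- `x_l` shifts weights by `χ_l`, so its value at any `h` is the weight of `m l - ex (a l)` under
  -- `h`.
  have hχ : ∀ l h, D.χ l h = W h (m l - ex (a l)) := fun l h => by
    rw [AddChar.map_sub_eq_div,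
      char_eq_of_coeff_ne_zero hp hγ (hW h) (hσ h) (ρ.grpHom_act_x h l) (hm l),
      mul_div_cancel_right]
  have hidx : ∀ i j, idx (a i) = idx (a j) := fun i j =>
    Fin.ext (Nat.succ_injective ((ha i).trans (ha j).symm))
  have hc : ∀ l, D.χ l (D.g l) ^ 2 ≠ 1 := fun l => (pow_ne_one_of_three_le_orderOf (hB l)).2
  have hcompat : ∀ i j, i ≠ j → D.χ i (D.g j) * D.χ j (D.g i) = 1 := fun i j hij => by
    rw [D.compat i j hij, inv_mul_cancel]
  rcases ht.eq_or_lt with ht1 | ht2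
  -- For `t = 1` the characters are determined by their value at the single `v`, which is `γ⁻¹` for
  -- every `g_l`. All indices then form one fibre.
  · have hWeq : ∀ i j, W (D.g i) = W (D.g j) := by
      intro i j
      have h0 : ∀ l, (idx (a l) : ℕ) = 0 := fun l => by have := ha l; omega
      ext1 n
      refine addChar_eq_of_single _ _ n fun b _ => ?_
      cases b with
      | inl b => rw [← zeta_succ, hW, hW]
      | inr b =>
        have hb : ∀ l, b = idx (a l) := fun l => Fin.ext (by have := b.2; have := h0 l; omega)
        change W _ (eps b) = W _ (eps b)
        rw [hb i, (hA i).char_eps hp (hW _) (hadm i) (h0 i), hidx i j,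
          (hA j).char_eps hp (hW _) (hadm j) (h0 j)]
    have := card_le_two_mul_of_fibres (fun _ : Fin θ => ()) (fun l => D.χ l (D.g l)) hc
      fun i j hij _ => by
        rw [← hcompat i j hij, hχ i (D.g i), hχ j (D.g j), hχ i (D.g j), hχ j (D.g i),
          hWeq i j]
    simp at this
    omega
  -- Since all `a l` have top index, `isLeft` determines `a l`. Two fibres of size at most two give
  -- `θ ≤ 4`, which suffices as `t ≥ 2`.
  · have := card_le_two_mul_of_fibres (fun l => (a l).isLeft) (fun l => D.χ l (D.g l)) hc
      fun i j hij h => by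
        have hij' : a j = a i := by
          have h2 := hidx i j
          revert h h2
          rcases a i with i' | i' <;> rcases a j with j' | j' <;> simp [idx, eq_comm]
        -- With `d_i = m i - ex (a i)`, `e1` becomes `comm d_i d_j * χ_i(g_i) = χ_j(g_i)` and `e2`
        -- its mirror image. In their product the two pairings cancel.
        have e1 := (hA i).comm_sub_mul_char (m' := m j) (hW _) (hadm i) (hij' ▸ hadm j)
        have e2 := (hA j).comm_sub_mul_char (m' := m i) (hW _) (hadm j) (hij' ▸ hadm i)
        rw [← hχ] at e1 e2
        have e3 : W (D.g i) (m j - ex (a i)) = D.χ j (D.g i) := by rw [hχ, hij']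
        have e4 : W (D.g j) (m i - ex (a j)) = D.χ i (D.g j) := by rw [hχ, hij']
        rw [e3] at e1
        rw [e4, comm_swap, hij'] at e2
        have := hcompat i j hij
        rw [← e1, ← e2] at this
        rw [← this, mul_mul_mul_comm, inv_mul_cancel, one_mul, mul_comm]
    simp at this
    omega
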